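/- Let $r,s,n$ be positive integers with $s\mid r$, and put $\zeta_r=e^{2\pi i/r}$. For $1\le i<j\le n$ and $0\le k<r$ let $\sigma_{ij}^{k/r}\in \mathrm{GL}_n(\mathbb C)$ be the reflection $$(a_1,\dots,a_i,\dots,a_j,\dots,a_n)\mapsto(a_1,\dots,\zeta_r^{-k}a_j,\dots,\zeta_r^{k}a_i,\dots,a_n),$$ and for $1\le i\le n$ and $0<k<r/s$ let $\tau_i^{sk/r}\in \mathrm{GL}_n(\mathbb C)$ be the reflection that multiplies the $i$-th coordinate by $\zeta_r^{sk}$. Let $R$ be the set of all these reflections and let $G(r,s,n)\subset\mathrm{GL}_n(\mathbb C)$ be the group generated by $R$; in particular $G(r,s,1)=\mu_{r/s}$ is the group of $(r/s)$-th roots of unity. For $\omega\in G(r,s,n)$ let $\pi(\omega)\in S_n$ be the permutation matrix obtained by replacing every nonzero entry of $\omega$ by $1$, let $\phi(\omega)\in\mu_{r/s}=G(r,s,1)$ be the product of the nonzero entries of $\omega$, and let $\delta(\omega)=1$ if $\phi(\omega)=1$ and $\delta(\omega)=0$ otherwise. The factorization series of an element $\omega$ of $G(r,s,n)$ is the formal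 power series $$f^\omega(x)=\sum_{m\ge0}f_m^\omega\frac{x^m}{m!},\qquad f_m^\omega=\#\{(\rho_1,\dots,\rho_m)\in R^m : \rho_m\cdots\rho_1=\omega\};$$ the series $f^{\phi(\omega)}(x)$ is the factorization series of $\phi(\omega)$ as an element of $G(r,s,1)$. If $\omega\in G(r,s,n)$ is such that $\pi(\omega)$ is a long cycle (its cycle type is $(n)$), then $$f^\omega(x)=\frac{1}{n!\,r^{n-1}}\,f^{\phi(\omega)}(nx)\,\bigl(e^{xrn/2}-e^{-xrn/2}\bigr)^{n-1},$$ where $$f^{\phi(\omega)}(x)=\frac{1}{r/s}\bigl(e^{(r/s-1)x}-e^{-x}\bigr)+\delta(\omega)e^{-x}.$$ If moreover $s=1$ and $\phi(\omega)\ne1$ (which includes the Coxeter elements of $G(r,1,n)$ for $r\ge2$), this gives the Chapuy–Stump formula $$f^\omega(x)=\frac{1}{|G(r,1,n)|}\bigl(e^{x|R|/n}-e^{-x|R^*|/n}\bigr)^{n},$$ where $R^*$ is the set of reflecting hyperplanes, i.e. of fixed spaces of the elements of $R$. -/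

import Mathlib

noncomputable section

namespace ReflectionFactorization

/-- The primitive `r`-th root of unity `ζ_r = e^{2πi/r}`. -/
def zeta (r : ℕ) : ℂ := Complex.exp (2 * Real.pi * Complex.I / r)

theorem zeta_ne_zero (r : ℕ) : zeta r ≠ 0 := Complex.exp_ne_zero _

/-- The matrix of `σ_{ij}^{k/r}` (for `i ≠ j`), that is of the map
`(a_1, …, a_i, …, a_j, …, a_n) ↦ (a_1, …, ζ_r^{-k} a_j, …, ζ_r^k a_i, …, a_n)`. -/
def sigmaMatrix (r : ℕ) {n : ℕ} (i j : Fin n) (k : ℕ) : Matrix (Fin n) (Fin n) ℂ :=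
  Matrix.of fun a b =>
    if a = i then (if b = j then (zeta r ^ k)⁻¹ else 0)
    else if a = j then (if b = i then zeta r ^ k else 0)
    else if b = a then 1 else 0

/-- The matrix of `τ_i^{k/r}`, that is of the map multiplying the `i`-th coordinate
by `ζ_r^k`. -/
def tauMatrix (r : ℕ) {n : ℕ} (i : Fin n) (k : ℕ) : Matrix (Fin n) (Fin n) ℂ :=
  Matrix.diagonal fun a => if a = i then zeta r ^ k else 1

theorem sigmaMatrix_mulVec (r : ℕ) {n : ℕ} (i j : Fin n) (k : ℕ) (v : Fin n → ℂ) :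
    (sigmaMatrix r i j k).mulVec v = fun a =>
      if a = i then (zeta r ^ k)⁻¹ * v j else if a = j then zeta r ^ k * v i else v a := by
  funext a
  simp only [Matrix.mulVec, dotProduct, sigmaMatrix, Matrix.of_apply]
  split_ifs <;> simp

theorem sigmaMatrix_mul_self (r : ℕ) {n : ℕ} {i j : Fin n} (h : i ≠ j) (k : ℕ) :
    sigmaMatrix r i j k * sigmaMatrix r i j k = 1 := by
  have hz : zeta r ^ k ≠ 0 := pow_ne_zero _ (zeta_ne_zero r)
  apply Matrix.toLin'.injective
  refine LinearMap.ext fun v => ?_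
  simp only [Matrix.toLin'_apply, ← Matrix.mulVec_mulVec, sigmaMatrix_mulVec, Matrix.one_mulVec]
  funext a
  by_cases ha : a = i
  · subst ha
    simp [h.symm, hz]
  · by_cases hb : a = j
    · subst hb
      simp [ha, hz]
    · simp [ha, hb]

theorem tauMatrix_mul_inv (r : ℕ) {n : ℕ} (i : Fin n) (k : ℕ) :
    tauMatrix r i k * Matrix.diagonal (fun a => if a = i then (zeta r ^ k)⁻¹ else 1) = 1 := by
  have hz : zeta r ^ k ≠ 0 := pow_ne_zero _ (zeta_ne_zero r)
  rw [tauMatrix, Matrix.diagonal_mul_diagonal, ← Matrix.diagonal_one]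
  congr 1
  funext a
  split_ifs <;> simp [hz]

/-- The reflection `σ_{ij}^{k/r}` as an element of `GL_n(ℂ)`. -/
def sigma (r : ℕ) {n : ℕ} (i j : Fin n) (h : i < j) (k : ℕ) : GL (Fin n) ℂ where
  val := sigmaMatrix r i j k
  inv := sigmaMatrix r i j k
  val_inv := sigmaMatrix_mul_self r h.ne k
  inv_val := sigmaMatrix_mul_self r h.ne k

/-- The element `τ_i^{k/r}` of `GL_n(ℂ)`. -/
def tau (r : ℕ) {n : ℕ} (i : Fin n) (k : ℕ) : GL (Fin n) ℂ where
  val := tauMatrix r i k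
  inv := Matrix.diagonal fun a => if a = i then (zeta r ^ k)⁻¹ else 1
  val_inv := tauMatrix_mul_inv r i k
  inv_val := mul_eq_one_comm.mp (tauMatrix_mul_inv r i k)

/-- The set `R` of reflections of `G(r,s,n)`: all `σ_{ij}^{k/r}` with `i < j` and `0 ≤ k < r`,
and all `τ_i^{sk/r}` with `0 < k < r/s`. -/
def reflections (r s n : ℕ) : Set (GL (Fin n) ℂ) :=
  {ρ | ∃ (i j : Fin n) (h : i < j) (k : ℕ), k < r ∧ ρ = sigma r i j h k} ∪
  {ρ | ∃ (i : Fin n) (k : ℕ), 0 < k ∧ k < r / s ∧ ρ = tau r i (s * k)}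

/-- The complex reflection group `G(r,s,n)`, generated by its set `R` of reflections. -/
def reflectionGroup (r s n : ℕ) : Subgroup (GL (Fin n) ℂ) :=
  Subgroup.closure (reflections r s n)

/-- The reflecting hyperplanes of `G(r,s,n)`: the fixed spaces of its reflections. -/
def reflectingHyperplanes (r s n : ℕ) : Set (Set (Fin n → ℂ)) :=
  {H | ∃ ρ ∈ reflections r s n, H = {v | ρ.1.mulVec v = v}}

/-- `π`: replace every nonzero entry of a matrix by `1`. On `G(r,s,n)` the value is a
permutation matrix. -/
def piMatrix {n : ℕ} (ω : GL (Fin n) ℂ) : Matrix (Fin n) (Fin n) ℂ :=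
  Matrix.of fun a b => if ω.1 a b = 0 then 0 else 1

/-- `M` is the matrix of a long cycle of `S_n`, i.e. of a permutation `c` of the standard basis
vectors (`v_b ↦ v_{c b}`) whose cycle type is `(n)`. -/
def IsLongCycle {n : ℕ} (M : Matrix (Fin n) (Fin n) ℂ) : Prop :=
  ∃ c : Equiv.Perm (Fin n), c.IsCycleOn Set.univ ∧
    M = Matrix.of fun a b => if a = c b then 1 else 0

/-- `φ`: the product of all nonzero entries of a matrix. -/
def phi {n : ℕ} (ω : GL (Fin n) ℂ) : ℂˣ :=
  ∏ a, ∏ b, if h : ω.1 a b = 0 then 1 else Units.mk0 (ω.1 a b) h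

/-- The identification of scalars `κ ∈ ℂˣ` with `GL_1(ℂ)`; it identifies `μ_{r/s}` with
`G(r,s,1)`. -/
def toGLOne (κ : ℂˣ) : GL (Fin 1) ℂ :=
  Units.map (Matrix.scalar (Fin 1) : ℂ →+* Matrix (Fin 1) (Fin 1) ℂ).toMonoidHom κ

/-- `δ(ω) = 1` if `φ(ω) = 1`, and `δ(ω) = 0` otherwise. -/
def delta {n : ℕ} (ω : GL (Fin n) ℂ) : ℚ :=
  open Classical in if phi ω = 1 then 1 else 0

/-- `F^ω_m`: the `m`-tuples of reflections of `G(r,s,n)` with `ρ_m ⋯ ρ_1 = ω`. -/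
def factorizations (r s : ℕ) {n : ℕ} (ω : GL (Fin n) ℂ) (m : ℕ) :
    Set (Fin m → GL (Fin n) ℂ) :=
  {ρ | (∀ t, ρ t ∈ reflections r s n) ∧ (List.ofFn ρ).reverse.prod = ω}

/-- `f^ω(x) = ∑ₘ f^ω_m x^m / m!` with `f^ω_m = |F^ω_m|`, for `ω ∈ G(r,s,n)`. -/
def factorizationSeries (r s : ℕ) {n : ℕ} (ω : GL (Fin n) ℂ) : PowerSeries ℚ :=
  PowerSeries.mk fun m => ((factorizations r s ω m).ncard : ℚ) / (m.factorial : ℚ)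

/-- The formal power series `e^{ax}`. -/
def expSeries (a : ℚ) : PowerSeries ℚ := PowerSeries.rescale a (PowerSeries.exp ℚ)

/-- The set of reflections is finite, so that all sets counted here are finite. -/
theorem reflections_finite (r s n : ℕ) : (reflections r s n).Finite := by
  refine Set.Finite.union ?_ ?_
  · refine (Set.finite_range (fun p : {q : Fin n × Fin n // q.1 < q.2} × Fin r =>
      sigma r p.1.1.1 p.1.1.2 p.1.2 p.2)).subset ?_
    rintro ρ ⟨i, j, h, k, hk, rfl⟩
    exact ⟨(⟨(i, j), h⟩, ⟨k, hk⟩), rfl⟩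
  · refine (Set.finite_range (fun p : Fin n × Fin (r / s) =>
      tau r p.1 (s * (p.2 : ℕ)))).subset ?_
    rintro ρ ⟨i, k, -, hk, rfl⟩
    exact ⟨(i, ⟨k, hk⟩), rfl⟩

theorem factorizations_finite (r s : ℕ) {n : ℕ} (ω : GL (Fin n) ℂ) (m : ℕ) :
    (factorizations r s ω m).Finite :=
  (Set.Finite.pi' fun _ : Fin m => reflections_finite r s n).subset fun _ h => h.1

end ReflectionFactorization

end

/-!
For a group `M` and a family `ρ` of elements, splitting off the last letter of a word shows that the
exponential generating functions `wordSeries ρ g` of factorizations of `g : M` are the unique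
solution of the linear system `F_g' = ∑ i, F_{ρ i⁻¹ g}` with initial value `δ_{g,1}`, so a closed
formula for them is verified by differentiating it.

An element of `G(r, s, n)` is a monomial matrix, i.e. an element of `μ_r ≀ S_n`, and sending it to
the pair (permutation, product of the entries) is a homomorphism to `S_n × μ_r`. Over an
`n`-cycle the elements of a fibre are conjugate under diagonal matrices, and conjugation by those
permutes the reflections, so all `r ^ (n - 1)` of them have the same series. In `S_n × μ_r` the
reflections become `r` copies of each transposition and `n` copies of each nontrivial element of
`μ_{r/s}`, which commute; hence
`f^ω(x) = r^{-(n-1)} f^c(r x) f^{φ(ω)}(n x)` with `f^c` the series of an `n`-cycle `c` with respect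
to transpositions.

For `f^c`, only hook characters matter, and they are the coefficients of
`det (1 - X P_c) / (1 - X)`. The matrix determinant lemma evaluates the sum of these polynomials
over `τ c`, `τ` a transposition, so the coefficients are eigenfunctions; at `X = 1` the polynomial
vanishes unless `c` is an `n`-cycle, which isolates the `n`-cycles.
-/

noncomputable section

namespace ReflectionFactorization

section ExpSeries

open PowerSeries

theorem coeff_expSeries (a : ℚ) (m : ℕ) : coeff m (expSeries a) = a ^ m / m.factorial := by
  simp [expSeries, coeff_rescale, coeff_exp, div_eq_mul_inv]

theorem constantCoeff_expSeries (a : ℚ) : constantCoeff (expSeries a) = 1 := by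
  rw [← coeff_zero_eq_constantCoeff_apply, coeff_expSeries]
  simp

theorem expSeries_add (a b : ℚ) : expSeries (a + b) = expSeries a * expSeries b :=
  (exp_mul_exp_eq_exp_add a b).symm

theorem expSeries_sub_expSeries (a b : ℚ) :
    expSeries a - expSeries b =
      expSeries ((a + b) / 2) * (expSeries ((a - b) / 2) - expSeries (-((a - b) / 2))) := by
  rw [mul_sub, ← expSeries_add, ← expSeries_add]
  ring_nf

theorem expSeries_pow (a : ℚ) (k : ℕ) : expSeries a ^ k = expSeries (k * a) := by
  rw [expSeries, ← map_pow, exp_pow_eq_rescale_exp, rescale_rescale, expSeries, mul_comm]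

theorem rescale_expSeries (a b : ℚ) : rescale a (expSeries b) = expSeries (a * b) := by
  rw [expSeries, rescale_rescale, expSeries, mul_comm]

theorem derivative_rescale (a : ℚ) (f : ℚ⟦X⟧) :
    d⁄dX ℚ (rescale a f) = a • rescale a (d⁄dX ℚ f) := by
  ext m
  simp only [coeff_derivative, coeff_rescale, coeff_smul, smul_eq_mul]
  ring

theorem derivative_expSeries (a : ℚ) : d⁄dX ℚ (expSeries a) = a • expSeries a := by
  rw [expSeries, derivative_rescale, derivative_exp]

theorem rescale_smul (a b : ℚ) (f : ℚ⟦X⟧) : rescale a (b • f) = b • rescale a f := by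
  ext m
  simp only [coeff_rescale, coeff_smul, smul_eq_mul]
  ring

theorem constantCoeff_rescale (a : ℚ) (f : ℚ⟦X⟧) :
    constantCoeff (rescale a f) = constantCoeff f := by
  simp_rw [← coeff_zero_eq_constantCoeff_apply, coeff_rescale, pow_zero, one_mul]

theorem eq_of_derivative_eq_sum {S I : Type*} [Fintype I] {w : I → ℚ} {a : I → S → S}
    {F G : S → ℚ⟦X⟧} (hF : ∀ s, d⁄dX ℚ (F s) = ∑ i, w i • F (a i s))
    (hG : ∀ s, d⁄dX ℚ (G s) = ∑ i, w i • G (a i s))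
    (h0 : ∀ s, constantCoeff (F s) = constantCoeff (G s)) : F = G := by
  suffices h : ∀ m s, coeff m (F s) = coeff m (G s) from funext fun s => ext fun m => h m s
  intro m
  induction m with
  | zero => simpa only [coeff_zero_eq_constantCoeff_apply] using h0
  | succ m ih =>
    intro s
    have hcoeff : coeff m (d⁄dX ℚ (F s)) = coeff m (d⁄dX ℚ (G s)) := by
      simp only [hF, hG, map_sum, coeff_smul, ih]
    rw [coeff_derivative, coeff_derivative] at hcoeff
    exact mul_right_cancel₀ (by positivity) hcoeff

theorem eq_smul_expSeries {a : ℚ} {f : ℚ⟦X⟧} (hf : d⁄dX ℚ f = a • f) :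
    f = constantCoeff f • expSeries a := by
  refine congrFun (eq_of_derivative_eq_sum (S := Unit) (I := Unit) (w := fun _ => a)
    (a := fun _ => id) (F := fun _ => f) (G := fun _ => constantCoeff f • expSeries a)
    ?_ ?_ ?_) ()
  · simpa using hf
  · simp [derivative_expSeries, smul_comm a]
  · simp [constantCoeff_expSeries]

end ExpSeries

section Words

open PowerSeries

variable {I M N : Type*} [Group M] [Group N]

/-- The product `ρ (t (m - 1)) ⋯ ρ (t 0)` of a word, in the right-to-left order in which
`factorizations` multiplies. -/
def wordProd (ρ : I → M) {m : ℕ} (t : Fin m → I) : M := (List.ofFn fun k => ρ (t k)).reverse.prod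

theorem wordProd_snoc (ρ : I → M) {m : ℕ} (t : Fin m → I) (i : I) :
    wordProd ρ (Fin.snoc t i : Fin (m + 1) → I) = ρ i * wordProd ρ t := by
  simp only [wordProd, List.ofFn_succ', Fin.snoc_castSucc, Fin.snoc_last, List.concat_eq_append,
    List.reverse_append, List.reverse_singleton, List.prod_append, List.prod_singleton]

theorem map_wordProd (f : M →* N) (ρ : I → M) {m : ℕ} (t : Fin m → I) :
    f (wordProd ρ t) = wordProd (f ∘ ρ) t := by
  simp only [wordProd, map_list_prod, List.map_reverse, List.map_ofFn, Function.comp_def]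

/-- The exponential generating function of the number of words of length `m` over the family `ρ`
with product `g`. -/
def wordSeries (ρ : I → M) (g : M) : ℚ⟦X⟧ :=
  PowerSeries.mk fun m => (Nat.card {t : Fin m → I // wordProd ρ t = g} : ℚ) / m.factorial

theorem constantCoeff_wordSeries [DecidableEq M] (ρ : I → M) (g : M) :
    constantCoeff (wordSeries ρ g) = if g = 1 then 1 else 0 := by
  rw [← coeff_zero_eq_constantCoeff_apply, wordSeries, coeff_mk]
  by_cases hg : g = 1
  · simp [wordProd, hg]
  · simp [wordProd, hg, Ne.symm hg]

theorem wordSeries_comp_of_injective (ρ : I → M) {f : M →* N} (hf : Function.Injective f) (g : M) :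
    wordSeries (f ∘ ρ) (f g) = wordSeries ρ g := by
  simp only [wordSeries, ← map_wordProd, hf.eq_iff]

variable [Fintype I]

theorem card_wordProd_eq_succ (ρ : I → M) (g : M) (m : ℕ) :
    Nat.card {t : Fin (m + 1) → I // wordProd ρ t = g} =
      ∑ i, Nat.card {t : Fin m → I // wordProd ρ t = (ρ i)⁻¹ * g} := by
  rw [← Nat.card_sigma]
  refine Nat.card_congr (.trans (.symm (.subtypeEquiv (Fin.snocEquiv fun _ => I) ?_))
    (.subtypeProdEquivSigmaSubtype fun i t => wordProd ρ t = (ρ i)⁻¹ * g))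
  rintro ⟨i, t⟩
  change _ ↔ wordProd ρ (Fin.snoc t i : Fin (m + 1) → I) = g
  rw [wordProd_snoc, eq_inv_mul_iff_mul_eq]

/-- Splitting off the last letter. -/
theorem derivative_wordSeries (ρ : I → M) (g : M) :
    d⁄dX ℚ (wordSeries ρ g) = ∑ i, wordSeries ρ ((ρ i)⁻¹ * g) := by
  ext m
  simp only [coeff_derivative, wordSeries, coeff_mk, map_sum, card_wordProd_eq_succ,
    Nat.factorial_succ, ← Finset.sum_div]
  push_cast
  field_simp

theorem eq_wordSeries [DecidableEq M] (ρ : I → M) {F : M → ℚ⟦X⟧}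
    (hF : ∀ g, d⁄dX ℚ (F g) = ∑ i, F ((ρ i)⁻¹ * g))
    (h0 : ∀ g, constantCoeff (F g) = if g = 1 then 1 else 0) (g : M) :
    F g = wordSeries ρ g :=
  congrFun (eq_of_derivative_eq_sum (w := fun _ => 1) (a := fun i g => (ρ i)⁻¹ * g)
    (by simpa using hF) (by simpa using derivative_wordSeries ρ)
    fun g => (h0 g).trans (constantCoeff_wordSeries ρ g).symm) g

theorem wordSeries_conj (ρ : I → M) {h : M}
    (hρ : ∀ f : M → ℚ⟦X⟧, ∑ i, f (h * ρ i * h⁻¹) = ∑ i, f (ρ i)) (g : M) :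
    wordSeries ρ (h * g * h⁻¹) = wordSeries ρ g := by
  classical
  refine eq_wordSeries ρ (F := fun g => wordSeries ρ (h * g * h⁻¹)) (fun g => ?_) (fun g => ?_) g
  · rw [derivative_wordSeries, ← hρ fun x => wordSeries ρ (x⁻¹ * (h * g * h⁻¹))]
    simp only [mul_inv_rev, inv_inv, mul_assoc, inv_mul_cancel_left]
  · simp only [constantCoeff_wordSeries, conj_eq_one_iff]

theorem sum_smul_wordSeries_of_eigenfunction [Fintype M] (ρ : I → M) {φ : M → ℚ} {a : ℚ}
    (hφ : ∀ g, ∑ i, φ (ρ i * g) = a * φ g) :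
    ∑ g, φ g • wordSeries ρ g = φ 1 • expSeries a := by
  classical
  rw [eq_smul_expSeries (a := a) (f := ∑ g, φ g • wordSeries ρ g)]
  · simp [constantCoeff_wordSeries]
  · simp only [map_sum, Derivation.map_smul, derivative_wordSeries, Finset.smul_sum, smul_smul,
      ← hφ, Finset.sum_smul]
    rw [Finset.sum_comm, Finset.sum_comm (γ := M) (α := I)]
    refine Finset.sum_congr rfl fun i _ => Fintype.sum_equiv (Equiv.mulLeft (ρ i)⁻¹) _ _ fun g => ?_
    simp

end Words

section WordMaps

open PowerSeries

variable {I M N : Type*} [Finite I] [Group M] [Group N]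

theorem wordSeries_comp_eq_sum [Fintype M] [DecidableEq N] (ρ : I → M) (f : M →* N) (h : N) :
    wordSeries (f ∘ ρ) h = ∑ g with f g = h, wordSeries ρ g := by
  classical
  have := Fintype.ofFinite I
  refine (eq_wordSeries (f ∘ ρ) (F := fun h => ∑ g with f g = h, wordSeries ρ g)
    (fun h => ?_) (fun h => ?_) h).symm
  · simp only [map_sum, derivative_wordSeries]
    rw [Finset.sum_comm]
    refine Finset.sum_congr rfl fun i _ => Finset.sum_equiv (Equiv.mulLeft (ρ i)⁻¹) ?_ ?_
    · simp
    · simp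
  · simp [constantCoeff_wordSeries, eq_comm]

theorem card_smul_wordSeries_of_surjective [Finite M] [Finite N] (ρ : I → M) {f : M →* N}
    (hf : Function.Surjective f) {g : M}
    (hg : ∀ g', f g' = f g → wordSeries ρ g' = wordSeries ρ g) :
    (Nat.card M : ℚ) • wordSeries ρ g = (Nat.card N : ℚ) • wordSeries (f ∘ ρ) (f g) := by
  classical
  have := Fintype.ofFinite M
  have := Fintype.ofFinite N
  have hcard : Fintype.card M = Fintype.card N * Finset.card {g' | f g' = f g} := by
    rw [← Finset.card_univ, Finset.card_eq_sum_card_fiberwise (f := f) (t := Finset.univ)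
      (fun _ _ => Finset.mem_univ _), Finset.sum_congr rfl fun y _ =>
      MonoidHom.card_fiber_eq_of_mem_range f (hf y) ⟨g, rfl⟩, Finset.sum_const, Finset.card_univ,
      smul_eq_mul]
  rw [wordSeries_comp_eq_sum,
    Finset.sum_congr rfl fun g' hg' => hg g' (Finset.mem_filter.mp hg').2, Finset.sum_const,
    Nat.card_eq_fintype_card, Nat.card_eq_fintype_card, hcard, Nat.cast_mul, mul_smul,
    Nat.cast_smul_eq_nsmul ℚ (Finset.card _)]

theorem wordSeries_sumElim_prod {J K L : Type*} [Finite J] [Fintype K] [Fintype L]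
    (α : I → M) (β : J → N) (p : M × N) :
    wordSeries (Sum.elim (fun x : I × K => (α x.1, (1 : N))) fun y : L × J => ((1 : M), β y.2)) p =
      rescale (Fintype.card K : ℚ) (wordSeries α p.1) *
        rescale (Fintype.card L : ℚ) (wordSeries β p.2) := by
  classical
  have := Fintype.ofFinite I
  have := Fintype.ofFinite J
  let F (p : M × N) : ℚ⟦X⟧ := rescale (Fintype.card K : ℚ) (wordSeries α p.1) *
    rescale (Fintype.card L : ℚ) (wordSeries β p.2)
  refine (eq_wordSeries _ (F := F) (fun p => ?_) (fun p => ?_) p).symm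
  · simp only [F, Derivation.leibniz, derivative_rescale, derivative_wordSeries, map_sum,
      Fintype.sum_sum_type, Sum.elim_inl, Sum.elim_inr, Fintype.sum_prod_type]
    simp only [Prod.inv_mk, inv_one, Prod.fst_mul, Prod.snd_mul, one_mul, Finset.sum_const,
      Finset.card_univ, smul_eq_mul, Finset.smul_sum, Finset.mul_sum, ← Nat.cast_smul_eq_nsmul ℚ,
      mul_smul_comm]
    rw [add_comm]
    simp only [mul_comm]
  · simp only [F, map_mul, constantCoeff_rescale, constantCoeff_wordSeries, Prod.ext_iff,
      Prod.fst_one, Prod.snd_one, ite_and, ite_mul, one_mul, zero_mul]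

theorem wordSeries_subtype_ne_one [Finite M] [DecidableEq M] (g : M) :
    wordSeries (Subtype.val : {g : M // g ≠ 1} → M) g =
      (Nat.card M : ℚ)⁻¹ • (expSeries (Nat.card M - 1) - expSeries (-1)) +
        if g = 1 then expSeries (-1) else 0 := by
  have := Fintype.ofFinite M
  have hM : (Nat.card M : ℚ) ≠ 0 := mod_cast Nat.card_pos.ne'
  let F (g : M) := (Nat.card M : ℚ)⁻¹ • (expSeries (Nat.card M - 1) - expSeries (-1)) +
    if g = 1 then expSeries (-1) else 0
  have hsum : ∑ g, F g = expSeries (Nat.card M - 1) := by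
    simp [F, Finset.sum_add_distrib, ← Nat.cast_smul_eq_nsmul ℚ, smul_smul]
  refine (eq_wordSeries _ (F := F) (fun g => ?_) (fun g => ?_) g).symm
  · have hne : ∑ b : {b : M // b ≠ 1}, F (b.1⁻¹ * g) = expSeries (Nat.card M - 1) - F g := by
      rw [← hsum, ← ((Equiv.inv M).trans (Equiv.mulRight g)).sum_comp,
        Fintype.sum_eq_add_sum_subtype_ne _ (1 : M)]
      simp
    rw [hne]
    simp only [F, map_add, Derivation.map_smul, map_sub, derivative_expSeries]
    split_ifs
    all_goals
      simp only [derivative_expSeries, map_zero]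
      match_scalars <;> field_simp <;> ring
  · simp only [F, map_add]
    split_ifs <;> simp [constantCoeff_expSeries]

end WordMaps

section Determinants

open Polynomial Matrix

variable {ι R : Type*} [Fintype ι] [DecidableEq ι] [CommRing R]

theorem derivative_det (A : Matrix ι ι R[X]) :
    derivative A.det = trace (adjugate A * A.map derivative) := by
  have hcol (i : ι) : (adjugate A * A.map derivative) i i =
      (A.updateCol i fun j => derivative (A j i)).det := by
    rw [← cramer_apply, cramer_eq_adjugate_mulVec]
    rfl
  simp only [trace, diag_apply, hcol, det_apply, Polynomial.derivative_sum]
  rw [Finset.sum_comm]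
  refine Finset.sum_congr rfl fun σ _ => ?_
  rw [derivative_smul, derivative_prod_finset, Finset.smul_sum]
  refine Finset.sum_congr rfl fun i _ => ?_
  rw [← Finset.prod_erase_mul _ _ (Finset.mem_univ i), updateCol_self]
  congr 2
  exact Finset.prod_congr rfl fun j hj => (updateCol_ne (Finset.ne_of_mem_erase hj)).symm

theorem det_add_vecMulVec_of_isUnit {A : Matrix ι ι R} (hA : IsUnit A.det) (u v : ι → R) :
    (A + vecMulVec u v).det = A.det + v ⬝ᵥ adjugate A *ᵥ u := by
  have hinv : A.det • (v ⬝ᵥ A⁻¹ *ᵥ u) = v ⬝ᵥ adjugate A *ᵥ u := by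
    rw [inv_def, smul_mulVec, dotProduct_smul, smul_smul, Ring.mul_inverse_cancel _ hA, one_smul]
  have hdet : (1 + replicateRow Unit v * A⁻¹ * replicateCol Unit u).det = 1 + v ⬝ᵥ A⁻¹ *ᵥ u := by
    rw [det_unique, Matrix.mul_assoc, ← replicateCol_mulVec]
    rfl
  rw [vecMulVec_eq Unit, det_add_replicateCol_mul_replicateRow hA, hdet, ← hinv, smul_eq_mul,
    mul_one_add]

theorem det_add_vecMulVec [IsDomain R] {A : Matrix ι ι R} (hA : A.det ≠ 0) (u v : ι → R) :
    (A + vecMulVec u v).det = A.det + v ⬝ᵥ adjugate A *ᵥ u := by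
  let f := algebraMap R (FractionRing R)
  have hf : Function.Injective f := IsFractionRing.injective R (FractionRing R)
  have hfA : IsUnit (f.mapMatrix A).det := by
    rwa [← RingHom.map_det, isUnit_iff_ne_zero, map_ne_zero_iff f hf]
  have hmap : f.mapMatrix (vecMulVec u v) = vecMulVec (f ∘ u) (f ∘ v) := by
    ext
    simp [vecMulVec_apply]
  apply hf
  rw [RingHom.map_det, map_add, hmap, det_add_vecMulVec_of_isUnit hfA, map_add, RingHom.map_det,
    RingHom.map_dotProduct, ← RingHom.map_adjugate, RingHom.mapMatrix_apply]
  congr 2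
  ext
  simp [RingHom.map_mulVec, Function.comp_def]

theorem X_mul_derivative_charpolyRev (M : Matrix ι ι R) :
    X * derivative M.charpolyRev = (Fintype.card ι : R[X]) * M.charpolyRev -
      trace (adjugate (1 - (X : R[X]) • M.map C)) := by
  have hderiv : (X : R[X]) • (1 - (X : R[X]) • M.map C).map derivative =
      (1 - (X : R[X]) • M.map C) - 1 := by
    ext1 i j
    by_cases h : i = j <;> simp [h, derivative_mul]
  rw [charpolyRev, derivative_det, ← smul_eq_mul, ← trace_smul, ← Matrix.mul_smul, hderiv, mul_sub,
    mul_one, adjugate_mul, trace_sub, trace_smul, trace_one, smul_eq_mul, mul_comm]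

omit [Fintype ι] in
theorem permMatrix_swap (i j : ι) : (Equiv.swap i j).permMatrix R =
    1 - vecMulVec (Pi.single i 1 - Pi.single j 1) (Pi.single i 1 - Pi.single j 1) := by
  ext1 a b
  simp only [PEquiv.toMatrix_apply, Equiv.toPEquiv_apply, Option.mem_some_iff,
    Equiv.swap_apply_def, Matrix.sub_apply, one_apply, vecMulVec_apply, Pi.sub_apply,
    Pi.single_apply]
  grind

theorem charpolyRev_ne_zero [Nontrivial R] (M : Matrix ι ι R) : M.charpolyRev ≠ 0 := fun h => by
  simpa [h] using M.eval_charpolyRev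

theorem natDegree_charpolyRev_le (M : Matrix ι ι R) :
    M.charpolyRev.natDegree ≤ Fintype.card ι := by
  nontriviality R
  rw [← reverse_charpoly]
  exact (reverse_natDegree_le _).trans_eq M.charpoly_natDegree_eq_dim

end Determinants

section HookPolynomial

open Polynomial Matrix

variable {ι : Type*} [Fintype ι] [DecidableEq ι]

/-- The matrix `1 - X P_c`, where `P_c` is the permutation matrix of `c`. -/
def permPencil (c : Equiv.Perm ι) : Matrix ι ι ℚ[X] := 1 - (X : ℚ[X]) • c.permMatrix ℚ[X]

/-- The quotient `det (1 - X P_c) / (1 - X)`, where `P_c` is the permutation matrix of `c`. Its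
coefficient at `X ^ k` is `(-1) ^ k` times the character of `c` on the `k`-th exterior power of the
standard representation, that is the irreducible character of hook shape `(n - k, 1 ^ k)`. -/
def hookPolynomial (c : Equiv.Perm ι) : ℚ[X] := -((c.permMatrix ℚ).charpolyRev /ₘ (X - C 1))

omit [Fintype ι] in
theorem permPencil_eq (c : Equiv.Perm ι) :
    permPencil c = 1 - (X : ℚ[X]) • (c.permMatrix ℚ).map C := by
  rw [permPencil, Equiv.Perm.permMatrix, Equiv.Perm.permMatrix, PEquiv.map_toMatrix]

theorem det_permPencil (c : Equiv.Perm ι) : (permPencil c).det = (c.permMatrix ℚ).charpolyRev := by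
  rw [permPencil_eq, charpolyRev]

theorem one_vecMul_permPencil (c : Equiv.Perm ι) :
    1 ᵥ* permPencil c = (1 - X : ℚ[X]) • (1 : ι → ℚ[X]) := by
  rw [permPencil, vecMul_sub, vecMul_one, vecMul_smul, vecMul_permMatrix, sub_smul, one_smul]
  rfl

theorem one_sub_X_mul_sum_adjugate (c : Equiv.Perm ι) (j : ι) :
    (1 - X) * ∑ i, adjugate (permPencil c) i j = (permPencil c).det := by
  have h : (1 - X : ℚ[X]) • (1 ᵥ* adjugate (permPencil c)) = (permPencil c).det • 1 := by
    rw [← smul_vecMul, ← one_vecMul_permPencil, vecMul_vecMul, mul_adjugate, vecMul_smul,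
      vecMul_one]
  simpa [vecMul, dotProduct] using congrFun h j

theorem one_sub_X_mul_hookPolynomial [Nonempty ι] (c : Equiv.Perm ι) :
    (1 - X) * hookPolynomial c = (permPencil c).det := by
  have hroot : IsRoot (permPencil c).det 1 := by
    rw [← one_sub_X_mul_sum_adjugate c (Classical.arbitrary ι)]
    simp
  rw [hookPolynomial, ← det_permPencil, mul_neg, ← neg_mul, neg_sub, ← C_1,
    mul_divByMonic_eq_iff_isRoot.mpr hroot]

theorem one_sub_X_ne_zero : (1 - X : ℚ[X]) ≠ 0 :=
  sub_ne_zero.mpr (X_ne_C 1).symm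

theorem sum_adjugate_permPencil (c : Equiv.Perm ι) (j : ι) :
    ∑ i, adjugate (permPencil c) i j = hookPolynomial c := by
  have : Nonempty ι := ⟨j⟩
  exact mul_left_cancel₀ one_sub_X_ne_zero
    ((one_sub_X_mul_sum_adjugate c j).trans (one_sub_X_mul_hookPolynomial c).symm)

theorem natDegree_hookPolynomial_lt [Nonempty ι] (c : Equiv.Perm ι) :
    (hookPolynomial c).natDegree < Fintype.card ι := by
  rw [hookPolynomial, natDegree_neg, natDegree_divByMonic _ (monic_X_sub_C 1), natDegree_X_sub_C]
  have := natDegree_charpolyRev_le (c.permMatrix ℚ)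
  have := Fintype.card_pos (α := ι)
  lia

theorem hookPolynomial_one [Nonempty ι] :
    hookPolynomial (1 : Equiv.Perm ι) = (1 - X) ^ (Fintype.card ι - 1) := by
  have h1 : permPencil (1 : Equiv.Perm ι) = (1 - X : ℚ[X]) • 1 := by
    rw [permPencil, permMatrix_one, sub_smul, one_smul]
  apply mul_left_cancel₀ one_sub_X_ne_zero
  rw [one_sub_X_mul_hookPolynomial, h1, det_smul, det_one, mul_one,
    mul_pow_sub_one Fintype.card_ne_zero]

theorem permPencil_swap_mul (c : Equiv.Perm ι) {i j : ι} {u : ι → ℚ[X]}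
    (hu : u = Pi.single i 1 - Pi.single j 1) : permPencil (Equiv.swap i j * c) =
      permPencil c + vecMulVec (u - permPencil c *ᵥ u) u := by
  rw [permPencil, permMatrix_mul, permMatrix_swap, ← hu, mul_sub, mul_one, mul_vecMulVec,
    permPencil, sub_mulVec, one_mulVec, sub_sub_cancel, smul_mulVec, smul_vecMulVec, smul_sub]
  abel

theorem det_permPencil_ne_zero (c : Equiv.Perm ι) : (permPencil c).det ≠ 0 :=
  det_permPencil c ▸ charpolyRev_ne_zero _

theorem det_permPencil_swap_mul (c : Equiv.Perm ι) (i j : ι) :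
    (permPencil (Equiv.swap i j * c)).det =
      (if i = j then 1 else -1) * (permPencil c).det +
        (adjugate (permPencil c) i i + adjugate (permPencil c) j j -
          adjugate (permPencil c) i j - adjugate (permPencil c) j i) := by
  let u : ι → ℚ[X] := Pi.single i 1 - Pi.single j 1
  have huu : u ⬝ᵥ u = if i = j then 0 else 2 := by
    by_cases h : i = j
    · simp [u, h]
    · norm_num [u, h, Ne.symm h]
  rw [permPencil_swap_mul c (u := u) rfl, det_add_vecMulVec (det_permPencil_ne_zero c), mulVec_sub,
    mulVec_mulVec, adjugate_mul, smul_mulVec, one_mulVec, dotProduct_sub, dotProduct_smul, huu]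
  simp only [u, mulVec_sub, sub_dotProduct, dotProduct_sub, mulVec_single_one,
    single_one_dotProduct, col_apply, smul_eq_mul]
  split_ifs <;> ring

theorem trace_adjugate_permPencil (c : Equiv.Perm ι) :
    trace (adjugate (permPencil c)) = (Fintype.card ι : ℚ[X]) * (permPencil c).det -
      X * derivative (permPencil c).det := by
  rw [permPencil_eq, ← charpolyRev, X_mul_derivative_charpolyRev, sub_sub_cancel]

theorem derivative_det_permPencil [Nonempty ι] (c : Equiv.Perm ι) :
    derivative (permPencil c).det =
      (1 - X) * derivative (hookPolynomial c) - hookPolynomial c := by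
  rw [← one_sub_X_mul_hookPolynomial, derivative_mul, derivative_sub, derivative_one,
    derivative_X]
  ring

theorem sum_hookPolynomial_swap_mul [Nonempty ι] (c : Equiv.Perm ι) :
    ∑ i, ∑ j, hookPolynomial (Equiv.swap i j * c) =
      (Fintype.card ι : ℚ[X]) ^ 2 * hookPolynomial c -
        2 * (Fintype.card ι : ℚ[X]) * X * derivative (hookPolynomial c) := by
  let n : ℚ[X] := Fintype.card ι
  apply mul_left_cancel₀ one_sub_X_ne_zero
  have htrace := trace_adjugate_permPencil c
  simp only [trace, diag_apply] at htrace
  have hsum : ∑ i, ∑ j, adjugate (permPencil c) i j = n * hookPolynomial c :=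
    Finset.sum_comm.trans (by simp [n, sum_adjugate_permPencil])
  have hsign : ∑ i : ι, ∑ j, ((if i = j then 1 else -1) * (permPencil c).det) =
      (2 * n - n ^ 2) * (permPencil c).det := by
    have (i j : ι) : (if i = j then 1 else -1 : ℚ[X]) = (if i = j then 2 else 0) - 1 := by
      split_ifs <;> norm_num
    simp only [this, ← Finset.sum_mul, Finset.sum_sub_distrib, Finset.sum_ite_eq, Finset.mem_univ,
      if_true, Finset.sum_const, Finset.card_univ, nsmul_eq_mul, n]
    ring
  calc (1 - X) * ∑ i, ∑ j, hookPolynomial (Equiv.swap i j * c)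
      = ∑ i, ∑ j, (permPencil (Equiv.swap i j * c)).det := by
        simp only [Finset.mul_sum, one_sub_X_mul_hookPolynomial]
    _ = (2 * n - n ^ 2) * (permPencil c).det +
          (2 * n * (n * (permPencil c).det - X * derivative (permPencil c).det) -
            2 * (n * hookPolynomial c)) := by
        simp only [det_permPencil_swap_mul, Finset.sum_add_distrib, Finset.sum_sub_distrib, hsign,
          Finset.sum_const, Finset.card_univ, nsmul_eq_mul, ← Finset.mul_sum, htrace, hsum,
          sum_adjugate_permPencil, n]
        ring
    _ = _ := by
        rw [derivative_det_permPencil, ← one_sub_X_mul_hookPolynomial]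
        ring

theorem adjugate_one_sub_permMatrix_apply {c : Equiv.Perm ι} {a i : ι} (ha : ¬ c.SameCycle a i)
    (j : ι) : adjugate (1 - c.permMatrix ℚ) i j = 0 := by
  let v : ι → ℚ := fun i => if c.SameCycle a i then 1 else 0
  have hker : (1 - c.permMatrix ℚ) *ᵥ v = 0 := by
    rw [sub_mulVec, one_mulVec, permMatrix_mulVec, sub_eq_zero]
    ext i
    simp [v, Equiv.Perm.sameCycle_apply_right]
  rw [adjugate_apply]
  refine exists_mulVec_eq_zero_iff.mp ⟨v, fun hv => ?_, ?_⟩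
  · simpa [v, Equiv.Perm.SameCycle.refl] using congrFun hv a
  · rw [updateRow_mulVec, hker, single_one_dotProduct]
    simp [v, ha]

theorem eval_one_hookPolynomial_of_not_isCycleOn {c : Equiv.Perm ι}
    (hc : ¬ c.IsCycleOn Set.univ) : (hookPolynomial c).eval 1 = 0 := by
  obtain ⟨a, b, hab⟩ : ∃ a b, ¬ c.SameCycle a b := by
    by_contra! h
    exact hc ⟨c.bijective.bijOn_univ, fun a _ b _ => h a b⟩
  have hmissed (i : ι) : ∃ a, ¬ c.SameCycle a i := by
    by_contra! h
    exact hab ((h a).trans (h b).symm)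
  have hmap : (evalRingHom 1).mapMatrix (permPencil c) = 1 - c.permMatrix ℚ := by
    ext1 i j
    by_cases h : i = j <;> simp [permPencil, h, PEquiv.toMatrix_apply, apply_ite (eval (1 : ℚ))]
  rw [← sum_adjugate_permPencil c b, ← coe_evalRingHom, map_sum]
  refine Finset.sum_eq_zero fun i _ => ?_
  obtain ⟨a, ha⟩ := hmissed i
  rw [← adjugate_one_sub_permMatrix_apply ha b, ← hmap, ← RingHom.map_adjugate]
  rfl

theorem derivative_sum_hookPolynomial [Nonempty ι] :
    derivative (∑ c : Equiv.Perm ι, hookPolynomial c) = 0 := by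
  have hinv : ∑ c : Equiv.Perm ι, ∑ i, ∑ j, hookPolynomial (Equiv.swap i j * c) =
      (Fintype.card ι : ℚ[X]) ^ 2 * ∑ c : Equiv.Perm ι, hookPolynomial c := by
    have h (i j : ι) : ∑ c, hookPolynomial (Equiv.swap i j * c) = ∑ c, hookPolynomial c :=
      Fintype.sum_equiv (Equiv.mulLeft (Equiv.swap i j)) _ _ fun _ => rfl
    rw [Finset.sum_comm, Finset.sum_congr rfl fun i _ => Finset.sum_comm]
    simp only [h, Finset.sum_const, Finset.card_univ, nsmul_eq_mul]
    ring
  simp only [sum_hookPolynomial_swap_mul, Finset.sum_sub_distrib, ← Finset.mul_sum,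
    ← derivative_sum, sub_eq_self] at hinv
  exact (mul_eq_zero_iff_left (by simp [Fintype.card_ne_zero])).mp hinv

theorem sum_eval_one_hookPolynomial [Nonempty ι] :
    ∑ c : Equiv.Perm ι, (hookPolynomial c).eval 1 = (Fintype.card ι).factorial := by
  have hzero (c : Equiv.Perm ι) : (hookPolynomial c).eval 0 = 1 := by
    simpa [det_permPencil] using congrArg (eval 0) (one_sub_X_mul_hookPolynomial c)
  rw [← eval_finsetSum, eq_C_of_derivative_eq_zero derivative_sum_hookPolynomial, eval_C,
    coeff_zero_eq_eval_zero, eval_finsetSum]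
  simp [hzero, Fintype.card_perm]

end HookPolynomial

section Transpositions

open Polynomial Equiv

theorem sum_sum_eq_two_nsmul_sum_lt {ι M : Type*} [Fintype ι] [LinearOrder ι] [AddCommMonoid M]
    {F : ι → ι → M} (hF : ∀ i j, F i j = F j i) :
    ∑ i, ∑ j, F i j = 2 • ∑ p : {p : ι × ι // p.1 < p.2}, F p.1.1 p.1.2 + ∑ i, F i i := by
  have hlt : ∑ p : {p : ι × ι // p.1 < p.2}, F p.1.1 p.1.2 =
      ∑ p : ι × ι with p.1 < p.2, F p.1 p.2 :=
    (Finset.sum_subtype _ (by simp) fun p : ι × ι => F p.1 p.2).symm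
  have hgt : ∑ p : ι × ι with p.2 < p.1, F p.1 p.2 = ∑ p : ι × ι with p.1 < p.2, F p.1 p.2 :=
    Finset.sum_equiv (Equiv.prodComm _ _) (by simp) fun p _ => hF _ _
  have hdiag : ∑ i, F i i = ∑ p : ι × ι with p.1 = p.2, F p.1 p.2 := by
    simp [Finset.sum_filter, Fintype.sum_prod_type]
  rw [hlt, hdiag, two_nsmul, ← Fintype.sum_prod_type fun p : ι × ι => F p.1 p.2]
  nth_rewrite 2 [← hgt]
  simp only [Finset.sum_filter, ← Finset.sum_add_distrib]
  refine Finset.sum_congr rfl fun p _ => ?_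
  rcases lt_trichotomy p.1 p.2 with h | h | h
  · simp [h, h.not_gt, h.ne]
  · simp [h]
  · simp [h, h.not_gt, h.ne']

variable {ι : Type*} [Fintype ι] [LinearOrder ι]

/-- The family of all transpositions, each listed once. -/
def transposition (p : {p : ι × ι // p.1 < p.2}) : Perm ι := swap p.1.1 p.1.2

omit [Fintype ι] in
theorem eq_of_pair_eq_pair {p q : {p : ι × ι // p.1 < p.2}}
    (h : ({p.1.1, p.1.2} : Set ι) = {q.1.1, q.1.2}) : p = q := by
  rcases Set.pair_eq_pair_iff.mp h with ⟨h1, h2⟩ | ⟨h1, h2⟩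
  · exact Subtype.ext (Prod.ext h1 h2)
  · exact absurd (h1 ▸ h2 ▸ p.2) q.2.not_gt

omit [Fintype ι] in
theorem transposition_injective : Function.Injective (transposition (ι := ι)) := by
  have hsupport (p : {p : ι × ι // p.1 < p.2}) :
      {x | transposition p x ≠ x} = {p.1.1, p.1.2} := by
    ext x
    simp [transposition, swap_apply_ne_self_iff, p.2.ne]
  intro p q h
  apply eq_of_pair_eq_pair
  rw [← hsupport, ← hsupport, h]

omit [Fintype ι] in
theorem transposition_ne_one (p : {p : ι × ι // p.1 < p.2}) : transposition p ≠ 1 :=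
  swap_eq_one_iff.not.mpr p.2.ne

theorem sum_sum_swap {M : Type*} [AddCommMonoid M] (f : Perm ι → M) :
    ∑ i, ∑ j, f (swap i j) = 2 • ∑ p : {p : ι × ι // p.1 < p.2}, f (transposition p) +
      Fintype.card ι • f 1 := by
  rw [sum_sum_eq_two_nsmul_sum_lt fun i j => congrArg f (swap_comm i j)]
  simp [transposition, Perm.one_def]

theorem sum_coeff_hookPolynomial_transposition_mul [Nonempty ι] (c : Perm ι) (k : ℕ) :
    ∑ p : {p : ι × ι // p.1 < p.2}, (hookPolynomial (transposition p * c)).coeff k =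
      (Fintype.card ι * (Fintype.card ι - 1) / 2 + k * -Fintype.card ι : ℚ) *
        (hookPolynomial c).coeff k := by
  have hk : (X * derivative (hookPolynomial c)).coeff k = k * (hookPolynomial c).coeff k := by
    cases k with
    | zero => simp
    | succ k => rw [coeff_X_mul, coeff_derivative, mul_comm, Nat.cast_succ]
  have h := congrArg (coeff · k) (sum_hookPolynomial_swap_mul c)
  rw [sum_sum_swap fun τ => hookPolynomial (τ * c), mul_assoc (2 * _)] at h
  simp only [coeff_add, coeff_sub, one_mul, nsmul_eq_mul, finsetSum_coeff,
    ← Nat.cast_pow, ← Nat.cast_ofNat (R := ℚ[X]), ← Nat.cast_mul, coeff_natCast_mul, hk] at h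
  push_cast at h
  linear_combination h / 2

omit [Fintype ι] in
theorem wordSeries_transposition_conj [Finite ι] (h g : Perm ι) :
    wordSeries transposition (h * g * h⁻¹) = wordSeries transposition g := by
  have := Fintype.ofFinite ι
  refine wordSeries_conj _ (fun f => ?_) g
  have hsum : ∑ i, ∑ j, f (h * swap i j * h⁻¹) = ∑ i, ∑ j, f (swap i j) := by
    simp only [← swap_apply_apply]
    exact (Equiv.sum_comp h fun i => ∑ j, f (swap i (h j))).trans
      (Finset.sum_congr rfl fun i _ => Equiv.sum_comp h fun j => f (swap i j))
  rw [sum_sum_swap f, sum_sum_swap fun g => f (h * g * h⁻¹), mul_one, mul_inv_cancel] at hsum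
  have : IsAddTorsionFree (PowerSeries ℚ) := .of_module_rat _
  exact nsmul_right_injective two_ne_zero (add_right_cancel hsum)

omit [Fintype ι] [LinearOrder ι] in
theorem isConj_of_isCycleOn_univ [Finite ι] {c c' : Perm ι} (hc : c.IsCycleOn Set.univ)
    (hc' : c'.IsCycleOn Set.univ) : IsConj c c' := by
  classical
  have := Fintype.ofFinite ι
  rcases subsingleton_or_nontrivial ι with hι | hι
  · rw [Subsingleton.elim c c']
  · have hcycle {c : Perm ι} (hc : c.IsCycleOn Set.univ) : c.IsCycle :=
      Perm.isCycle_iff_exists_isCycleOn.mpr ⟨_, Set.nontrivial_univ, hc, fun _ _ => trivial⟩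
    have hsupport {c : Perm ι} (hc : c.IsCycleOn Set.univ) : c.support = Finset.univ :=
      Finset.eq_univ_of_forall fun a =>
        Perm.mem_support.mpr (hc.apply_ne Set.nontrivial_univ (Set.mem_univ a))
    exact (hcycle hc).isConj (hcycle hc') (by rw [hsupport hc, hsupport hc'])

omit [Fintype ι] in
theorem wordSeries_transposition_eq_of_isCycleOn [Finite ι] {c c' : Perm ι}
    (hc : c.IsCycleOn Set.univ) (hc' : c'.IsCycleOn Set.univ) :
    wordSeries transposition c' = wordSeries transposition c := by
  obtain ⟨h, rfl⟩ := isConj_iff.mp (isConj_of_isCycleOn_univ hc hc')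
  exact wordSeries_transposition_conj h c

theorem sum_hookPolynomial_smul_wordSeries [Nonempty ι] :
    ∑ c : Perm ι, (hookPolynomial c).eval 1 • wordSeries transposition c =
      expSeries (Fintype.card ι * (Fintype.card ι - 1) / 2) *
        aeval (expSeries (-Fintype.card ι)) (hookPolynomial (1 : Perm ι)) := by
  have heval (c : Perm ι) := eval_eq_sum_range' (natDegree_hookPolynomial_lt c) 1
  simp only [heval, one_pow, mul_one, Finset.sum_smul]
  rw [Finset.sum_comm, aeval_eq_sum_range' (natDegree_hookPolynomial_lt 1), Finset.mul_sum]
  refine Finset.sum_congr rfl fun k _ => ?_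
  rw [sum_smul_wordSeries_of_eigenfunction transposition
    fun c => sum_coeff_hookPolynomial_transposition_mul c k, expSeries_add, ← expSeries_pow,
    mul_smul_comm]

/-- Jackson's formula. -/
theorem factorial_smul_wordSeries_transposition [Nonempty ι] {c : Perm ι}
    (hc : c.IsCycleOn Set.univ) :
    ((Fintype.card ι).factorial : ℚ) • wordSeries transposition c =
      (expSeries (Fintype.card ι / 2) - expSeries (-(Fintype.card ι / 2))) ^
        (Fintype.card ι - 1) := by
  have hclass (c' : Perm ι) : (hookPolynomial c').eval 1 • wordSeries transposition c' =
      (hookPolynomial c').eval 1 • wordSeries transposition c := by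
    by_cases hc' : c'.IsCycleOn Set.univ
    · rw [wordSeries_transposition_eq_of_isCycleOn hc hc']
    · rw [eval_one_hookPolynomial_of_not_isCycleOn hc', zero_smul, zero_smul]
  rw [← sum_eval_one_hookPolynomial, Finset.sum_smul, ← Finset.sum_congr rfl fun c' _ => hclass c',
    sum_hookPolynomial_smul_wordSeries, hookPolynomial_one]
  have hn : ((Fintype.card ι - 1 : ℕ) : ℚ) = Fintype.card ι - 1 := Nat.cast_pred Fintype.card_pos
  have h1 : expSeries (Fintype.card ι * (Fintype.card ι - 1) / 2) =
      expSeries (Fintype.card ι / 2) ^ (Fintype.card ι - 1) := by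
    rw [expSeries_pow, hn]
    congr 1
    ring
  have h2 : expSeries (Fintype.card ι / 2) * expSeries (-Fintype.card ι) =
      expSeries (-(Fintype.card ι / 2)) := by
    rw [← expSeries_add]
    congr 1
    ring
  rw [map_pow, map_sub, map_one, aeval_X, h1, ← mul_pow, mul_sub, mul_one, h2]

end Transpositions

section Coboundaries

open Equiv

variable {ι A : Type*} [CommGroup A]

/-- The multiplicative coboundary `v ↦ (v ∘ c) / v` of a permutation `c`. -/
def coboundary (c : Perm ι) : (ι → A) →* (ι → A) where
  toFun v := (v ∘ c) / v
  map_one' := by simp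
  map_mul' v w := by
    ext
    simp [mul_div_mul_comm]

theorem coboundary_apply (c : Perm ι) (v : ι → A) (i : ι) :
    coboundary c v i = v (c i) / v i := rfl

theorem eq_of_coboundary_eq_one [Finite ι] {c : Perm ι} (hc : c.IsCycleOn Set.univ) {v : ι → A}
    (hv : coboundary c v = 1) (i j : ι) : v i = v j := by
  obtain ⟨k, -, rfl⟩ := (hc.2 (Set.mem_univ i) (Set.mem_univ j)).exists_pow_eq'
  have hsemi : Function.Semiconj v c id := fun i => div_eq_one.mp (congrFun hv i)
  simpa [Perm.iterate_eq_pow] using (hsemi.iterate_right k i).symm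

/-- Both the image of the coboundary and the kernel of the product have index `|A|`. -/
theorem exists_coboundary_eq [Fintype ι] [Nonempty ι] [Finite A] {c : Perm ι}
    (hc : c.IsCycleOn Set.univ) {w : ι → A} (hw : ∏ i, w i = 1) :
    ∃ v, coboundary c v = w := by
  classical
  let P : (ι → A) →* A := ∏ i, Pi.evalMonoidHom (fun _ => A) i
  have hP (w : ι → A) : P w = ∏ i, w i := by simp [P, MonoidHom.finsetProd_apply]
  obtain ⟨i₀⟩ := ‹Nonempty ι›
  have hle : (coboundary (A := A) c).range ≤ P.ker := by
    rintro _ ⟨v, rfl⟩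
    rw [MonoidHom.mem_ker, hP]
    simp only [coboundary_apply, Finset.prod_div_distrib, Equiv.prod_comp c v, div_self']
  have hker : Nat.card (coboundary (A := A) c).ker ≤ Nat.card A :=
    Nat.card_le_card_of_injective (fun v => v.1 i₀) fun v w h => Subtype.ext <| funext fun i =>
      (eq_of_coboundary_eq_one hc v.2 i i₀).trans
        (h.trans (eq_of_coboundary_eq_one hc w.2 i₀ i))
  have hrange : Nat.card P.range = Nat.card A := by
    have hsurj : Function.Surjective P := fun a => ⟨Pi.mulSingle i₀ a, by simp [hP]⟩
    rw [MonoidHom.range_eq_top.mpr hsurj, Subgroup.card_top]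
  have hcob := (coboundary (A := A) c).ker.card_mul_index
  have hprod := P.ker.card_mul_index
  rw [Subgroup.index_ker] at hcob hprod
  have hcard : Nat.card P.ker ≤ Nat.card (coboundary (A := A) c).range := by
    refine Nat.le_of_mul_le_mul_right (c := Nat.card A) ?_ Nat.card_pos
    calc Nat.card P.ker * Nat.card A
        = Nat.card (coboundary (A := A) c).ker * Nat.card (coboundary (A := A) c).range := by
          rw [hcob, ← hprod, hrange]
      _ ≤ _ := (Nat.mul_le_mul_right _ hker).trans_eq (mul_comm _ _)
  exact (Subgroup.eq_of_le_of_card_ge hle hcard).ge (MonoidHom.mem_ker.mpr ((hP w).trans hw))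

end Coboundaries

section Monomial

open Equiv PowerSeries

/-- The group of monomial matrices with nonzero entries in `A`; an element `g` stands for the
matrix with the entry `g.left (g.right b)` at `(g.right b, b)`. -/
abbrev Monomial (A ι : Type*) [CommGroup A] :=
  (ι → A) ⋊[mulAutArrow (G := Perm ι) (A := ι) (M := A)] Perm ι

variable {A ι : Type*} [CommGroup A]

theorem Monomial.mul_left_apply (g h : Monomial A ι) (i : ι) :
    (g * h).left i = g.left i * h.left (g.right.symm i) := rfl

theorem Monomial.inl_mul_left_apply (v : ι → A) (g : Monomial A ι) (i : ι) :
    (SemidirectProduct.inl v * g).left i = v i * g.left i := rfl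

theorem Monomial.mul_inl_left_apply (g : Monomial A ι) (v : ι → A) (i : ι) :
    (g * SemidirectProduct.inl v).left i = g.left i * v (g.right.symm i) := rfl

/-- The product of the nonzero entries. -/
def Monomial.weight [Fintype ι] : Monomial A ι →* A where
  toFun g := ∏ i, g.left i
  map_one' := by simp
  map_mul' g h := by
    simp only [Monomial.mul_left_apply, Finset.prod_mul_distrib]
    congr 1
    exact Equiv.prod_comp g.right.symm h.left

theorem Monomial.weight_apply [Fintype ι] (g : Monomial A ι) : g.weight = ∏ i, g.left i := rfl

theorem Monomial.card_eq [Finite ι] :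
    Nat.card (Monomial A ι) = Nat.card A ^ Nat.card ι * (Nat.card ι).factorial := by
  rw [SemidirectProduct.card, Nat.card_fun, Nat.card_perm]

theorem Monomial.exists_inl_conj_eq [Fintype ι] [Nonempty ι] [Finite A]
    {g g' : Monomial A ι}
    (hg : g.right.IsCycleOn Set.univ) (hr : g'.right = g.right) (hw : g'.weight = g.weight) :
    ∃ v : ι → A, g' = SemidirectProduct.inl v * g * (SemidirectProduct.inl v)⁻¹ := by
  obtain ⟨v, hv⟩ := exists_coboundary_eq hg
    (w := fun i => g'.left (g.right i) / g.left (g.right i)) (by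
      rw [Finset.prod_div_distrib, Equiv.prod_comp g.right g'.left,
        Equiv.prod_comp g.right g.left, div_eq_one]
      exact hw)
  refine ⟨v, eq_mul_inv_of_mul_eq (SemidirectProduct.ext (funext fun i => ?_) ?_)⟩
  · have := congrFun hv (g.right.symm i)
    simp only [coboundary_apply, Equiv.apply_symm_apply] at this
    simp only [Monomial.mul_left_apply, SemidirectProduct.left_inl, SemidirectProduct.right_inl,
      hr, Perm.one_def, Equiv.refl_symm, Equiv.refl_apply]
    rw [div_eq_div_iff_mul_eq_mul] at this
    rw [← this]
  · simp [hr]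

variable [LinearOrder ι] (B : Subgroup A)

variable (ι) in
/-- Indices of the reflections with entries in `A` and determinants (up to sign) in `B`. -/
abbrev ReflectionIndex := ({p : ι × ι // p.1 < p.2} × A) ⊕ (ι × {b : B // b ≠ 1})

/-- The reflection with a given index. -/
def monomialReflection : ReflectionIndex ι B → Monomial A ι
  | .inl (p, a) => ⟨Pi.mulSingle p.1.1 a⁻¹ * Pi.mulSingle p.1.2 a, transposition p⟩
  | .inr (i, b) => ⟨Pi.mulSingle i (b : A), 1⟩

theorem monomialReflection_injective :
    Function.Injective (monomialReflection (ι := ι) B) := by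
  rintro (⟨p, a⟩ | ⟨i, b⟩) (⟨q, a'⟩ | ⟨j, b'⟩) h
  · obtain rfl : p = q := transposition_injective (congrArg SemidirectProduct.right h)
    have ha := congrFun (congrArg SemidirectProduct.left h) p.1.2
    simp only [monomialReflection, Pi.mul_apply, Pi.mulSingle_eq_of_ne p.2.ne', one_mul,
      Pi.mulSingle_eq_same] at ha
    rw [ha]
  · exact absurd (congrArg SemidirectProduct.right h) (transposition_ne_one p)
  · exact absurd (congrArg SemidirectProduct.right h).symm (transposition_ne_one q)
  · have hb := congrFun (congrArg SemidirectProduct.left h) i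
    rcases eq_or_ne i j with rfl | hij
    · simp only [monomialReflection, Pi.mulSingle_eq_same] at hb
      rw [Subtype.ext (Subtype.ext hb)]
    · simp only [monomialReflection, Pi.mulSingle_eq_same, Pi.mulSingle_eq_of_ne hij] at hb
      exact absurd (Subtype.ext hb) b.2

theorem wordSeries_monomialReflection_inl_conj [Finite ι] [Finite A] (v : ι → A)
    (g : Monomial A ι) :
    wordSeries (monomialReflection B)
      (SemidirectProduct.inl v * g * (SemidirectProduct.inl v)⁻¹) =
        wordSeries (monomialReflection B) g := by
  classical
  have := Fintype.ofFinite ι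
  have := Fintype.ofFinite A
  let e : ReflectionIndex ι B ≃ ReflectionIndex ι B :=
    .sumCongr (.prodShear (.refl _) fun p => .mulLeft (v p.1.2 * (v p.1.1)⁻¹)) (.refl _)
  have he (x : ReflectionIndex ι B) : monomialReflection B (e x) =
      SemidirectProduct.inl v * monomialReflection B x * (SemidirectProduct.inl v)⁻¹ := by
    refine eq_mul_inv_of_mul_eq (SemidirectProduct.ext (funext fun k => ?_) ?_)
    · obtain ⟨⟨⟨i, j⟩, hij⟩, a⟩ | ⟨i, b⟩ := x
      · simp only [e, monomialReflection, Monomial.inl_mul_left_apply,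
          Monomial.mul_inl_left_apply]
        rcases eq_or_ne k i with rfl | hi
        · simp [hij.ne, transposition, mul_comm]
        · rcases eq_or_ne k j with rfl | hj
          · simp [hij.ne', transposition, mul_assoc, mul_comm (v i)⁻¹]
          · simp [hi, hj, transposition, swap_apply_of_ne_of_ne]
      · exact mul_comm _ _
    · obtain ⟨⟨⟨i, j⟩, hij⟩, a⟩ | ⟨i, b⟩ := x <;> simp [e, monomialReflection]
  refine wordSeries_conj _ (fun f => ?_) g
  simp only [← he]
  exact e.sum_comp fun x => f (monomialReflection B x)

variable [Fintype ι]

theorem weight_monomialReflection_inl (p : {p : ι × ι // p.1 < p.2}) (a : A) :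
    (monomialReflection B (.inl (p, a))).weight = 1 := by
  simp [monomialReflection, Monomial.weight_apply, Finset.prod_mul_distrib]

theorem weight_monomialReflection_inr (i : ι) (b : {b : B // b ≠ 1}) :
    (monomialReflection B (.inr (i, b))).weight = b := by
  simp [monomialReflection, Monomial.weight_apply]

theorem weight_monomialReflection_mem (x : ReflectionIndex ι B) :
    (monomialReflection B x).weight ∈ B := by
  obtain ⟨p, a⟩ | ⟨i, b⟩ := x
  · exact weight_monomialReflection_inl B p a ▸ one_mem B
  · exact weight_monomialReflection_inr B i b ▸ b.1.2

theorem prod_weight_comp_monomialReflection :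
    (SemidirectProduct.rightHom.prod Monomial.weight) ∘ monomialReflection B =
      Sum.elim (fun x : {p : ι × ι // p.1 < p.2} × A => (transposition x.1, (1 : A)))
        fun y : ι × {b : B // b ≠ 1} => ((1 : Perm ι), (y.2.1 : A)) := by
  ext1 (⟨p, a⟩ | ⟨i, b⟩)
  · exact Prod.ext rfl (weight_monomialReflection_inl B p a)
  · exact Prod.ext rfl (weight_monomialReflection_inr B i b)

theorem card_pow_smul_wordSeries_monomialReflection [Nonempty ι] [Finite A] {g : Monomial A ι}
    (hg : g.right.IsCycleOn Set.univ) (hB : g.weight ∈ B) :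
    (Nat.card A : ℚ) ^ (Fintype.card ι - 1) • wordSeries (monomialReflection B) g =
      rescale (Nat.card A : ℚ) (wordSeries transposition g.right) *
        rescale (Fintype.card ι : ℚ)
          (wordSeries (Subtype.val : {b : B // b ≠ 1} → B) ⟨g.weight, hB⟩) := by
  have := Fintype.ofFinite A
  obtain ⟨i₀⟩ := ‹Nonempty ι›
  let f : Monomial A ι →* Perm ι × A := SemidirectProduct.rightHom.prod Monomial.weight
  have hf : Function.Surjective f := fun x =>
    ⟨⟨Pi.mulSingle i₀ x.2, x.1⟩, Prod.ext rfl (by simp [f, Monomial.weight_apply])⟩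
  have hfiber (g' : Monomial A ι) (h : f g' = f g) :
      wordSeries (monomialReflection B) g' = wordSeries (monomialReflection B) g := by
    obtain ⟨v, rfl⟩ := Monomial.exists_inl_conj_eq hg (congrArg Prod.fst h) (congrArg Prod.snd h)
    exact wordSeries_monomialReflection_inl_conj B v g
  have : Finite (Monomial A ι) := Finite.of_equiv _ SemidirectProduct.equivProd.symm
  have h := card_smul_wordSeries_of_surjective (monomialReflection B) hf hfiber
  rw [prod_weight_comp_monomialReflection,
    wordSeries_sumElim_prod transposition fun b : {b : B // b ≠ 1} => (b.1 : A),
    ← Nat.card_eq_fintype_card (α := A)] at h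
  rw [← wordSeries_comp_of_injective _ B.subtype_injective]
  have hcard : (Nat.card (Monomial A ι) : ℚ) =
      Nat.card (Perm ι × A) * (Nat.card A : ℚ) ^ (Fintype.card ι - 1) := by
    rw [Monomial.card_eq, Nat.card_prod, Nat.card_perm, Nat.card_eq_fintype_card (α := ι),
      ← pow_sub_one_mul (Fintype.card_ne_zero (α := ι)) (Nat.card A)]
    push_cast
    ring
  rw [hcard, mul_smul] at h
  exact smul_right_injective _ (Nat.cast_ne_zero.mpr Nat.card_pos.ne') h

theorem wordSeries_monomialReflection [Nonempty ι] [Finite A] {g : Monomial A ι}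
    (hg : g.right.IsCycleOn Set.univ) (hB : g.weight ∈ B) :
    wordSeries (monomialReflection B) g =
      ((Fintype.card ι).factorial * (Nat.card A : ℚ) ^ (Fintype.card ι - 1))⁻¹ •
        (rescale (Fintype.card ι : ℚ)
            (wordSeries (Subtype.val : {b : B // b ≠ 1} → B) ⟨g.weight, hB⟩) *
          (expSeries (Nat.card A * Fintype.card ι / 2) -
            expSeries (-(Nat.card A * Fintype.card ι / 2))) ^ (Fintype.card ι - 1)) := by
  have hjackson := congrArg (rescale (Nat.card A : ℚ)) (factorial_smul_wordSeries_transposition hg)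
  rw [rescale_smul, map_pow, map_sub, rescale_expSeries, rescale_expSeries, mul_neg,
    ← mul_div_assoc] at hjackson
  rw [eq_inv_smul_iff₀ (mul_ne_zero (Nat.cast_ne_zero.mpr (Nat.factorial_ne_zero _))
      (pow_ne_zero _ (Nat.cast_ne_zero.mpr Nat.card_pos.ne'))), mul_smul,
    card_pow_smul_wordSeries_monomialReflection B hg hB, ← hjackson, ← smul_mul_assoc, mul_comm]

end Monomial

section MonomialMatrices

open Equiv

variable {R ι : Type*} [CommRing R] {A : Subgroup Rˣ} [Fintype ι] [DecidableEq ι]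

/-- The monomial matrix represented by `g`: it maps the `b`-th basis vector to
`g.left (g.right b)` times the `g.right b`-th one. -/
def Monomial.toMatrix : Monomial A ι →* Matrix ι ι R where
  toFun g := Matrix.of fun a b => if a = g.right b then ((g.left a : Rˣ) : R) else 0
  map_one' := by
    ext a b
    by_cases h : a = b <;> simp [h, Matrix.one_apply]
  map_mul' g h := by
    ext a b
    simp only [Matrix.of_apply, Matrix.mul_apply, SemidirectProduct.mul_right, Perm.mul_apply,
      Monomial.mul_left_apply, mul_ite, mul_zero, ite_mul, zero_mul]
    rw [Finset.sum_ite_eq' Finset.univ (h.right b), if_pos (Finset.mem_univ _)]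
    by_cases hab : a = g.right (h.right b) <;> simp [hab]

/-- The monomial matrix represented by `g`, as an invertible matrix. -/
def Monomial.toGL : Monomial A ι →* GL ι R := Monomial.toMatrix.toHomUnits

theorem Monomial.toGL_apply (g : Monomial A ι) (a b : ι) :
    (toGL g).1 a b = if a = g.right b then ((g.left a : Rˣ) : R) else 0 := rfl

theorem Monomial.toGL_mulVec (g : Monomial A ι) (v : ι → R) (a : ι) :
    (toGL g).1.mulVec v a = ((g.left a : Rˣ) : R) * v (g.right.symm a) := by
  simp [Matrix.mulVec, dotProduct, Monomial.toGL_apply, ← Equiv.symm_apply_eq]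

variable [Nontrivial R]

theorem Monomial.toGL_apply_eq_zero_iff (g : Monomial A ι) (a b : ι) :
    (toGL g).1 a b = 0 ↔ a ≠ g.right b := by
  simp [Monomial.toGL_apply]

theorem Monomial.toGL_injective :
    Function.Injective (Monomial.toGL : Monomial A ι →* GL ι R) := by
  intro g h hgh
  have hentry (a b : ι) : (toGL g).1 a b = (toGL h).1 a b := by rw [hgh]
  have hright : g.right = h.right := Equiv.ext fun b => by
    by_contra hne
    rw [← ne_eq, ← Monomial.toGL_apply_eq_zero_iff, ← hentry,
      Monomial.toGL_apply_eq_zero_iff] at hne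
    exact hne rfl
  refine SemidirectProduct.ext (funext fun a => ?_) hright
  ext
  simpa [Monomial.toGL_apply, ← hright] using hentry a (g.right.symm a)

end MonomialMatrices

section ComplexMonomialMatrices

variable {A : Subgroup ℂˣ} {n : ℕ}

theorem isCycleOn_of_isLongCycle {g : Monomial A (Fin n)} (h : IsLongCycle (piMatrix g.toGL)) :
    g.right.IsCycleOn Set.univ := by
  obtain ⟨c, hc, hM⟩ := h
  convert hc
  ext1 b
  have := congrFun (congrFun hM (g.right b)) b
  by_contra hne
  simp [piMatrix, Monomial.toGL_apply_eq_zero_iff, hne] at this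

theorem phi_toGL (g : Monomial A (Fin n)) : phi g.toGL = (g.weight : ℂˣ) := by
  rw [phi, Monomial.weight_apply, Subgroup.val_finsetProd]
  refine Finset.prod_congr rfl fun a _ => ?_
  rw [Finset.prod_eq_single (g.right.symm a)]
  · ext
    simp [Monomial.toGL_apply]
  · intro b _ hb
    rw [dif_pos]
    rw [Monomial.toGL_apply_eq_zero_iff, ne_eq, ← Equiv.symm_apply_eq]
    exact hb.symm
  · simp

theorem toGL_inl_eq_toGLOne (a : A) :
    Monomial.toGL (SemidirectProduct.inl (fun _ => a) : Monomial A (Fin 1)) = toGLOne a := by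
  ext i j
  simp [Monomial.toGL_apply, toGLOne, Subsingleton.elim i j]

theorem factorizationSeries_eq_wordSeries {r s : ℕ} {I : Type*} {ρ : I → GL (Fin n) ℂ}
    (hinj : Function.Injective ρ) (hρ : Set.range ρ = reflections r s n) (ω : GL (Fin n) ℂ) :
    factorizationSeries r s ω = wordSeries ρ ω := by
  have himage (m : ℕ) : factorizations r s ω m =
      (ρ ∘ ·) '' {t : Fin m → I | wordProd ρ t = ω} := by
    ext σ
    simp only [factorizations, ← hρ, Set.mem_image]
    constructor
    · rintro ⟨hmem, hprod⟩
      choose t ht using hmem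
      obtain rfl : ρ ∘ t = σ := funext ht
      exact ⟨t, hprod, rfl⟩
    · rintro ⟨t, ht, rfl⟩
      exact ⟨fun k => ⟨t k, rfl⟩, ht⟩
  simp only [factorizationSeries, wordSeries, himage, ← Nat.card_coe_set_eq,
    Nat.card_image_of_injective (hinj.comp_left (α := Fin _))]
  rfl

end ComplexMonomialMatrices

section RootsOfUnity

variable {r s n : ℕ} [NeZero r]

theorem zeta_isPrimitiveRoot : IsPrimitiveRoot (zeta r) r :=
  Complex.isPrimitiveRoot_exp r (NeZero.ne r)

/-- `ζ_r^k` as an element of the group of `r`-th roots of unity. -/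
def zetaPow (r : ℕ) [NeZero r] (k : ℕ) : rootsOfUnity r ℂ :=
  rootsOfUnity.mkOfPowEq (zeta r ^ k) (by
    rw [pow_right_comm, zeta_isPrimitiveRoot.pow_eq_one, one_pow])

theorem coe_zetaPow (k : ℕ) : ((zetaPow r k : ℂˣ) : ℂ) = zeta r ^ k := rfl

theorem exists_zetaPow_eq (a : rootsOfUnity r ℂ) : ∃ k < r, zetaPow r k = a := by
  obtain ⟨k, hk, h⟩ := zeta_isPrimitiveRoot.eq_pow_of_pow_eq_one
    ((mem_rootsOfUnity' r (a : ℂˣ)).mp a.2)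
  exact ⟨k, hk, by ext; exact h⟩

theorem zetaPow_eq_one_iff (k : ℕ) : zetaPow r k = 1 ↔ r ∣ k := by
  rw [← zeta_isPrimitiveRoot.pow_eq_one_iff_dvd, ← coe_zetaPow]
  simp

/-- The subgroup `μ_{r/s}` of the group of `r`-th roots of unity. -/
def quotientRoots (r s : ℕ) : Subgroup (rootsOfUnity r ℂ) :=
  (rootsOfUnity (r / s) ℂ).subgroupOf (rootsOfUnity r ℂ)

theorem card_quotientRoots (hsr : s ∣ r) : Nat.card (quotientRoots r s) = r / s := by
  have : NeZero (r / s) := ⟨(Nat.div_pos (Nat.le_of_dvd (NeZero.pos r) hsr)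
    (Nat.pos_of_dvd_of_pos hsr (NeZero.pos r))).ne'⟩
  rw [quotientRoots, Nat.card_congr (Subgroup.subgroupOfEquivOfLe
    (rootsOfUnity_le_of_dvd (Nat.div_dvd_of_dvd hsr))).toEquiv, Complex.card_rootsOfUnity]

theorem zetaPow_mem_quotientRoots (hsr : s ∣ r) (k : ℕ) :
    zetaPow r k ∈ quotientRoots r s ↔ s ∣ k := by
  have hs : 0 < s := Nat.pos_of_dvd_of_pos hsr (NeZero.pos r)
  rw [quotientRoots, Subgroup.mem_subgroupOf, mem_rootsOfUnity', coe_zetaPow, ← pow_mul,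
    zeta_isPrimitiveRoot.pow_eq_one_iff_dvd]
  obtain ⟨d, rfl⟩ := hsr
  have hd : 0 < d := Nat.pos_of_mul_pos_left (NeZero.pos (s * d))
  rw [Nat.mul_div_cancel_left d hs, Nat.mul_dvd_mul_iff_right hd]

end RootsOfUnity

section Reflections

open Equiv

variable {r s n : ℕ} [NeZero r]

theorem toGL_monomialReflection_inl {i j : Fin n} (h : i < j) (k : ℕ) :
    (monomialReflection (quotientRoots r s) (.inl (⟨(i, j), h⟩, zetaPow r k))).toGL =
      sigma r i j h k := by
  ext a b
  have hab : a = swap i j b ↔ b = swap i j a := by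
    rw [eq_comm, swap_apply_eq_iff]
  simp only [Monomial.toGL_apply, monomialReflection, transposition, sigma, sigmaMatrix,
    Matrix.of_apply, hab]
  rcases eq_or_ne a i with rfl | hi
  · simp [h.ne, coe_zetaPow]
  · rcases eq_or_ne a j with rfl | hj
    · simp [hi, coe_zetaPow]
    · simp [hi, hj, swap_apply_of_ne_of_ne]

theorem toGL_monomialReflection_inr (i : Fin n) {k : ℕ} (hk : zetaPow r k ∈ quotientRoots r s)
    (h1 : (⟨zetaPow r k, hk⟩ : quotientRoots r s) ≠ 1) :
    (monomialReflection (quotientRoots r s) (.inr (i, ⟨⟨zetaPow r k, hk⟩, h1⟩))).toGL =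
      tau r i k := by
  ext a b
  simp only [Monomial.toGL_apply, monomialReflection, tau, tauMatrix, Matrix.diagonal_apply,
    Perm.one_apply]
  rcases eq_or_ne a i with rfl | hi
  · simp [coe_zetaPow]
  · simp [hi]

theorem range_toGL_monomialReflection (hsr : s ∣ r) :
    Set.range (Monomial.toGL ∘ monomialReflection (quotientRoots r s)) = reflections r s n := by
  have hs : 0 < s := Nat.pos_of_dvd_of_pos hsr (NeZero.pos r)
  ext ρ
  constructor
  · rintro ⟨⟨⟨⟨i, j⟩, h⟩, a⟩ | ⟨i, ⟨⟨b, hb⟩, hb1⟩⟩, rfl⟩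
    · obtain ⟨k, hk, rfl⟩ := exists_zetaPow_eq a
      exact Or.inl ⟨i, j, h, k, hk, toGL_monomialReflection_inl h k⟩
    · obtain ⟨k, hk, rfl⟩ := exists_zetaPow_eq b
      obtain ⟨l, rfl⟩ := (zetaPow_mem_quotientRoots hsr k).mp hb
      refine Or.inr ⟨i, l, Nat.pos_of_ne_zero ?_, (Nat.lt_div_iff_mul_lt' hsr l).mpr hk,
        toGL_monomialReflection_inr i hb hb1⟩
      rintro rfl
      exact hb1 (Subtype.ext ((zetaPow_eq_one_iff _).mpr (by simp)))
  · rintro (⟨i, j, h, k, -, rfl⟩ | ⟨i, k, hk, hkr, rfl⟩)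
    · exact ⟨_, toGL_monomialReflection_inl h k⟩
    · refine ⟨_, toGL_monomialReflection_inr i
        ((zetaPow_mem_quotientRoots hsr _).mpr (dvd_mul_right s k)) fun h => ?_⟩
      have hdvd := (zetaPow_eq_one_iff (s * k)).mp (congrArg Subtype.val h)
      exact (Nat.le_of_dvd (Nat.mul_pos hs hk) hdvd).not_gt
        ((Nat.lt_div_iff_mul_lt' hsr k).mp hkr)

theorem toGL_monomialReflection_mem (hsr : s ∣ r)
    (x : ReflectionIndex (Fin n) (quotientRoots r s)) :
    (monomialReflection (quotientRoots r s) x).toGL ∈ reflectionGroup r s n :=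
  Subgroup.subset_closure (range_toGL_monomialReflection hsr ▸ Set.mem_range_self x)

theorem exists_toGL_eq_of_mem (hsr : s ∣ r) {ω : GL (Fin n) ℂ}
    (hω : ω ∈ reflectionGroup r s n) :
    ∃ g : Monomial (rootsOfUnity r ℂ) (Fin n), g.weight ∈ quotientRoots r s ∧ g.toGL = ω := by
  suffices h : reflectionGroup r s n ≤
      ((quotientRoots r s).comap Monomial.weight).map Monomial.toGL from h hω
  rw [reflectionGroup, Subgroup.closure_le, ← range_toGL_monomialReflection hsr]
  rintro _ ⟨x, rfl⟩
  exact ⟨_, weight_monomialReflection_mem _ x, rfl⟩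

theorem factorizationSeries_toGL (hsr : s ∣ r) (g : Monomial (rootsOfUnity r ℂ) (Fin n)) :
    factorizationSeries r s g.toGL = wordSeries (monomialReflection (quotientRoots r s)) g := by
  rw [factorizationSeries_eq_wordSeries
    (Monomial.toGL_injective.comp (monomialReflection_injective _))
    (range_toGL_monomialReflection hsr), wordSeries_comp_of_injective _ Monomial.toGL_injective]

end Reflections

section FactorizationSeries

open PowerSeries

variable {r s n : ℕ} [NeZero r]

theorem toGLOne_mem_reflectionGroup (hsr : s ∣ r) (b : quotientRoots r s) :
    toGLOne (b : rootsOfUnity r ℂ) ∈ reflectionGroup r s 1 := by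
  rw [← toGL_inl_eq_toGLOne]
  by_cases hb : b = 1
  · subst hb
    exact one_mem _
  · convert toGL_monomialReflection_mem hsr (.inr ((0 : Fin 1), ⟨b, hb⟩))
    refine SemidirectProduct.ext (funext fun i => ?_) rfl
    simp [monomialReflection, Subsingleton.elim i 0]

theorem factorizationSeries_toGLOne (hsr : s ∣ r) (b : quotientRoots r s) :
    factorizationSeries r s (toGLOne (b : rootsOfUnity r ℂ)) =
      wordSeries (Subtype.val : {b : quotientRoots r s // b ≠ 1} → quotientRoots r s) b := by
  let g : Monomial (rootsOfUnity r ℂ) (Fin 1) := SemidirectProduct.inl fun _ => b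
  have hg : g.right.IsCycleOn Set.univ :=
    ⟨g.right.bijective.bijOn_univ, fun i _ j _ => Subsingleton.elim i j ▸ .rfl⟩
  have hw : g.weight = b := by simp [g, Monomial.weight_apply]
  rw [← toGL_inl_eq_toGLOne, factorizationSeries_toGL hsr,
    wordSeries_monomialReflection _ hg (hw ▸ b.2)]
  simp [hw]

theorem factorizationSeries_of_isLongCycle (hsr : s ∣ r) [NeZero n] {ω : GL (Fin n) ℂ}
    (hω : ω ∈ reflectionGroup r s n) (hπ : IsLongCycle (piMatrix ω)) :
    factorizationSeries r s ω =
      ((n.factorial : ℚ) * (r : ℚ) ^ (n - 1))⁻¹ •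
        (rescale (n : ℚ) (factorizationSeries r s (toGLOne (phi ω))) *
        (expSeries ((r : ℚ) * n / 2) - expSeries (-((r : ℚ) * n / 2))) ^ (n - 1)) := by
  obtain ⟨g, hB, rfl⟩ := exists_toGL_eq_of_mem hsr hω
  rw [phi_toGL, factorizationSeries_toGLOne hsr ⟨g.weight, hB⟩, factorizationSeries_toGL hsr,
    wordSeries_monomialReflection _ (isCycleOn_of_isLongCycle hπ) hB, Fintype.card_fin,
    Complex.card_rootsOfUnity]

theorem exists_mem_quotientRoots_eq_phi (hsr : s ∣ r) {ω : GL (Fin n) ℂ}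
    (hω : ω ∈ reflectionGroup r s n) :
    ∃ b : quotientRoots r s, phi ω = (b : rootsOfUnity r ℂ) := by
  obtain ⟨g, hB, rfl⟩ := exists_toGL_eq_of_mem hsr hω
  exact ⟨⟨g.weight, hB⟩, phi_toGL g⟩

theorem factorizationSeries_toGLOne_phi (hsr : s ∣ r) {ω : GL (Fin n) ℂ}
    (hω : ω ∈ reflectionGroup r s n) :
    factorizationSeries r s (toGLOne (phi ω)) =
      ((r : ℚ) / s)⁻¹ • (expSeries ((r : ℚ) / s - 1) - expSeries (-1)) +
        delta ω • expSeries (-1) := by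
  classical
  obtain ⟨b, hb⟩ := exists_mem_quotientRoots_eq_phi hsr hω
  have hs : (s : ℚ) ≠ 0 := mod_cast (Nat.pos_of_dvd_of_pos hsr (NeZero.pos r)).ne'
  rw [delta, hb, factorizationSeries_toGLOne hsr, wordSeries_subtype_ne_one,
    card_quotientRoots hsr, Nat.cast_div hsr hs]
  simp only [OneMemClass.coe_eq_one, ite_smul, one_smul, zero_smul]

end FactorizationSeries

section Cardinalities

open Equiv

theorem card_lt_pairs {ι : Type*} [Finite ι] [LinearOrder ι] :
    (Nat.card {p : ι × ι // p.1 < p.2} : ℚ) = Nat.card ι * (Nat.card ι - 1) / 2 := by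
  have := Fintype.ofFinite ι
  have h := sum_sum_eq_two_nsmul_sum_lt (ι := ι) (F := fun _ _ => (1 : ℚ)) fun _ _ => rfl
  simp only [Finset.sum_const, Finset.card_univ, ← Nat.card_eq_fintype_card, nsmul_eq_mul,
    mul_one, Nat.cast_ofNat] at h
  linear_combination -h / 2

variable {r s n : ℕ} [NeZero r]

theorem ncard_reflections (hsr : s ∣ r) :
    ((reflections r s n).ncard : ℚ) = n * (n - 1) / 2 * r + n * ((r : ℚ) / s - 1) := by
  have hs : (s : ℚ) ≠ 0 := mod_cast (Nat.pos_of_dvd_of_pos hsr (NeZero.pos r)).ne'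
  have hB : (Nat.card {b : quotientRoots r s // b ≠ 1} : ℚ) = (r : ℚ) / s - 1 := by
    classical
    have := Fintype.ofFinite (quotientRoots r s)
    have h := Fintype.sum_eq_add_sum_subtype_ne (fun _ => (1 : ℚ)) (1 : quotientRoots r s)
    simp only [Finset.sum_const, Finset.card_univ, ← Nat.card_eq_fintype_card,
      card_quotientRoots hsr, nsmul_eq_mul, mul_one, Nat.cast_div hsr hs] at h
    rw [h, add_sub_cancel_left]
  rw [← range_toGL_monomialReflection hsr, ← Nat.card_coe_set_eq, Nat.card_range_of_injective
    (Monomial.toGL_injective.comp (monomialReflection_injective _)), Nat.card_sum, Nat.card_prod,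
    Nat.card_prod, Complex.card_rootsOfUnity]
  push_cast
  rw [card_lt_pairs, hB, Nat.card_fin]

theorem toGL_inl_mem_reflectionGroup_one (v : Fin n → rootsOfUnity r ℂ) :
    Monomial.toGL (SemidirectProduct.inl v : Monomial (rootsOfUnity r ℂ) (Fin n)) ∈
      reflectionGroup r 1 n := by
  suffices h : v ∈ ((reflectionGroup r 1 n).comap Monomial.toGL).comap SemidirectProduct.inl from h
  refine Subgroup.pi_mem_of_mulSingle_mem _ fun i => ?_
  by_cases hv : v i = 1
  · rw [hv, Pi.mulSingle_one]
    exact one_mem _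
  · have hmem : v i ∈ quotientRoots r 1 := by
      obtain ⟨k, -, hk⟩ := exists_zetaPow_eq (v i)
      exact hk ▸ (zetaPow_mem_quotientRoots (one_dvd r) k).mpr (one_dvd k)
    exact toGL_monomialReflection_mem (one_dvd r)
      (.inr (i, ⟨⟨v i, hmem⟩, fun h => hv (congrArg Subtype.val h)⟩))

theorem toGL_inr_mem_reflectionGroup (hsr : s ∣ r) (p : Perm (Fin n)) :
    Monomial.toGL (SemidirectProduct.inr p : Monomial (rootsOfUnity r ℂ) (Fin n)) ∈
      reflectionGroup r s n := by
  have hlt {i j : Fin n} (hij : i < j) :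
      Monomial.toGL (SemidirectProduct.inr (swap i j) : Monomial (rootsOfUnity r ℂ) (Fin n)) ∈
        reflectionGroup r s n := by
    have := toGL_monomialReflection_mem hsr (.inl (⟨(i, j), hij⟩, (1 : rootsOfUnity r ℂ)))
    simp only [monomialReflection, inv_one, Pi.mulSingle_one, mul_one] at this
    exact this
  induction p using Perm.swap_induction_on with
  | one => exact one_mem _
  | swap_mul f i j hij hf =>
    rw [map_mul, map_mul]
    refine mul_mem ?_ hf
    rcases lt_or_gt_of_ne hij with h | h
    · exact hlt h
    · exact swap_comm i j ▸ hlt h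

theorem range_toGL :
    (Monomial.toGL : Monomial (rootsOfUnity r ℂ) (Fin n) →* _).range = reflectionGroup r 1 n := by
  ext ω
  constructor
  · rintro ⟨g, rfl⟩
    rw [← SemidirectProduct.inl_left_mul_inr_right g, map_mul]
    exact mul_mem (toGL_inl_mem_reflectionGroup_one g.left)
      (toGL_inr_mem_reflectionGroup (one_dvd r) g.right)
  · intro hω
    obtain ⟨g, -, hg⟩ := exists_toGL_eq_of_mem (one_dvd r) hω
    exact ⟨g, hg⟩

theorem card_reflectionGroup_one :
    Nat.card (reflectionGroup r 1 n) = r ^ n * n.factorial := by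
  rw [← range_toGL, ← Nat.card_congr (MonoidHom.ofInjective Monomial.toGL_injective).toEquiv,
    Monomial.card_eq, Complex.card_rootsOfUnity, Nat.card_fin]

end Cardinalities

section Hyperplanes

open Equiv

variable {K ι : Type*} [Field K] [LinearOrder ι] {A : Subgroup Kˣ}

variable (A ι) in
/-- The reflecting hyperplanes `a v_i = v_j` and `v_i = 0` of the monomial reflections. -/
def hyperplane : ({p : ι × ι // p.1 < p.2} × A) ⊕ ι → Set (ι → K)
  | .inl (p, a) => {v | ((a : Kˣ) : K) * v p.1.1 = v p.1.2}
  | .inr i => {v | v i = 0}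

theorem setOf_single_notMem_hyperplane_inl (p : {p : ι × ι // p.1 < p.2}) (a : A) :
    {x | Pi.single x 1 ∉ hyperplane ι A (.inl (p, a))} = {p.1.1, p.1.2} := by
  obtain ⟨⟨i, j⟩, hij : i < j⟩ := p
  ext x
  rcases eq_or_ne x i with rfl | hi
  · simp [hyperplane, hij.ne']
  · rcases eq_or_ne x j with rfl | hj
    · simp [hyperplane, hi.symm]
    · simp [hyperplane, hi, hj, hi.symm, hj.symm]

theorem setOf_single_notMem_hyperplane_inr (i : ι) :
    {x | Pi.single x 1 ∉ hyperplane ι A (.inr i)} = {i} := by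
  ext x
  simp [hyperplane, Pi.single_apply, eq_comm]

theorem hyperplane_inl_ne_inr (p : {p : ι × ι // p.1 < p.2}) (a : A) (i : ι) :
    hyperplane ι A (.inl (p, a)) ≠ hyperplane ι A (.inr i) := by
  intro h
  have hpair : ({p.1.1, p.1.2} : Set ι) = {i} := by
    rw [← setOf_single_notMem_hyperplane_inl p a, h, setOf_single_notMem_hyperplane_inr]
  exact p.2.ne (Set.subsingleton_singleton.anti hpair.le (Set.mem_insert _ _)
    (Set.mem_insert_of_mem _ rfl))

theorem hyperplane_injective : Function.Injective (hyperplane ι A) := by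
  rintro (⟨p, a⟩ | i) (⟨q, b⟩ | j) h
  · obtain rfl : p = q := eq_of_pair_eq_pair <| by
      rw [← setOf_single_notMem_hyperplane_inl p a, h, setOf_single_notMem_hyperplane_inl]
    have hmem : (Pi.single p.1.1 1 + Pi.single p.1.2 ((a : Kˣ) : K)) ∈
        hyperplane ι A (.inl (p, a)) := by
      simp [hyperplane, p.2.ne, p.2.ne']
    rw [h] at hmem
    have hba : b = a := by
      ext
      simpa [hyperplane, p.2.ne, p.2.ne'] using hmem
    rw [hba]
  · exact absurd h (hyperplane_inl_ne_inr p a j)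
  · exact absurd h.symm (hyperplane_inl_ne_inr q b i)
  · refine congrArg Sum.inr (Set.singleton_injective ?_)
    rw [← setOf_single_notMem_hyperplane_inr (A := A), h, setOf_single_notMem_hyperplane_inr]

variable [Fintype ι] (B : Subgroup A)

theorem fixedSpace_monomialReflection_inl (p : {p : ι × ι // p.1 < p.2}) (a : A) :
    {v | (monomialReflection B (.inl (p, a))).toGL.1.mulVec v = v} =
      hyperplane ι A (.inl (p, a)) := by
  obtain ⟨⟨i, j⟩, hij : i < j⟩ := p
  ext v
  simp only [Set.mem_ofPred_eq, funext_iff, Monomial.toGL_mulVec, monomialReflection,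
    transposition, symm_swap, hyperplane]
  constructor
  · intro h
    simpa [hij.ne'] using h j
  · intro h x
    rcases eq_or_ne x i with rfl | hi
    · simp [hij.ne, ← h]
    · rcases eq_or_ne x j with rfl | hj
      · simp [hi, h]
      · simp [hi, hj, swap_apply_of_ne_of_ne]

theorem fixedSpace_monomialReflection_inr (i : ι) (b : {b : B // b ≠ 1}) :
    {v | (monomialReflection B (.inr (i, b))).toGL.1.mulVec v = v} =
      hyperplane ι A (.inr i) := by
  have hb : (((b : A) : Kˣ) : K) ≠ 1 := fun h => b.2 (Subtype.ext (Subtype.ext (Units.ext h)))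
  ext v
  simp only [Set.mem_ofPred_eq, funext_iff, Monomial.toGL_mulVec, monomialReflection,
    Perm.one_def, refl_symm, refl_apply, hyperplane]
  constructor
  · intro h
    have hi := h i
    rw [Pi.mulSingle_eq_same] at hi
    by_contra h0
    exact hb ((mul_eq_right₀ h0).mp hi)
  · intro h x
    rcases eq_or_ne x i with rfl | hi
    · simp [h]
    · simp [hi]

end Hyperplanes

section ChapuyStump

open PowerSeries

variable {r s n : ℕ} [NeZero r]

theorem range_hyperplane (hsr : s ∣ r) [Nontrivial (quotientRoots r s)] :
    Set.range (hyperplane (Fin n) (rootsOfUnity r ℂ)) = reflectingHyperplanes r s n := by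
  ext H
  simp only [reflectingHyperplanes, ← range_toGL_monomialReflection hsr, Set.exists_range_iff]
  constructor
  · rintro ⟨⟨p, a⟩ | i, rfl⟩
    · exact ⟨.inl (p, a), (fixedSpace_monomialReflection_inl _ p a).symm⟩
    · obtain ⟨b, hb⟩ := exists_ne (1 : quotientRoots r s)
      exact ⟨.inr (i, ⟨b, hb⟩), (fixedSpace_monomialReflection_inr _ i ⟨b, hb⟩).symm⟩
  · rintro ⟨⟨p, a⟩ | ⟨i, b⟩, rfl⟩
    · exact ⟨.inl (p, a), (fixedSpace_monomialReflection_inl _ p a).symm⟩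
    · exact ⟨.inr i, (fixedSpace_monomialReflection_inr _ i b).symm⟩

theorem ncard_reflectingHyperplanes (hsr : s ∣ r) [Nontrivial (quotientRoots r s)] :
    ((reflectingHyperplanes r s n).ncard : ℚ) = n * (n - 1) / 2 * r + n := by
  rw [← range_hyperplane hsr, ← Nat.card_coe_set_eq,
    Nat.card_range_of_injective hyperplane_injective, Nat.card_sum, Nat.card_prod,
    Complex.card_rootsOfUnity]
  push_cast
  rw [card_lt_pairs, Nat.card_fin]

theorem expSeries_ncard_reflections_sub [NeZero n] [Nontrivial (quotientRoots r 1)] :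
    expSeries (((reflections r 1 n).ncard : ℚ) / n) -
        expSeries (-(((reflectingHyperplanes r 1 n).ncard : ℚ) / n)) =
      expSeries (r / 2 - 1) * (expSeries ((r : ℚ) * n / 2) - expSeries (-((r : ℚ) * n / 2))) := by
  have hn : (n : ℚ) ≠ 0 := NeZero.ne _
  have hsum : (((reflections r 1 n).ncard : ℚ) / n +
      -(((reflectingHyperplanes r 1 n).ncard : ℚ) / n)) / 2 = r / 2 - 1 := by
    rw [ncard_reflections (one_dvd r), ncard_reflectingHyperplanes (one_dvd r), Nat.cast_one]
    field_simp
    ring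
  have hdiff : (((reflections r 1 n).ncard : ℚ) / n -
      -(((reflectingHyperplanes r 1 n).ncard : ℚ) / n)) / 2 = r * n / 2 := by
    rw [ncard_reflections (one_dvd r), ncard_reflectingHyperplanes (one_dvd r), Nat.cast_one]
    field_simp
    ring
  rw [expSeries_sub_expSeries, hsum, hdiff]

theorem factorizationSeries_of_phi_ne_one [NeZero n] {ω : GL (Fin n) ℂ}
    (hω : ω ∈ reflectionGroup r 1 n) (hπ : IsLongCycle (piMatrix ω)) (hφ : phi ω ≠ 1) :
    factorizationSeries r 1 ω =
      (Nat.card (reflectionGroup r 1 n) : ℚ)⁻¹ •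
        (expSeries (((reflections r 1 n).ncard : ℚ) / n) -
          expSeries (-(((reflectingHyperplanes r 1 n).ncard : ℚ) / n))) ^ n := by
  have : Nontrivial (quotientRoots r 1) := by
    obtain ⟨b, hb⟩ := exists_mem_quotientRoots_eq_phi (one_dvd r) hω
    exact nontrivial_of_ne b 1 (by rintro rfl; exact hφ hb)
  let D := expSeries ((r : ℚ) * n / 2) - expSeries (-((r : ℚ) * n / 2))
  have hone : rescale (n : ℚ) (factorizationSeries r 1 (toGLOne (phi ω))) =
      (r : ℚ)⁻¹ • (expSeries (n * (r / 2 - 1)) * D) := by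
    have hsum : ((n : ℚ) * (r - 1) + n * -1) / 2 = n * (r / 2 - 1) := by ring
    have hdiff : ((n : ℚ) * (r - 1) - n * -1) / 2 = r * n / 2 := by ring
    rw [factorizationSeries_toGLOne_phi (one_dvd r) hω, delta, if_neg hφ, zero_smul, add_zero,
      rescale_smul, map_sub, rescale_expSeries, rescale_expSeries, expSeries_sub_expSeries,
      Nat.cast_one, div_one, hsum, hdiff]
  have hcard : (Nat.card (reflectionGroup r 1 n) : ℚ) =
      n.factorial * (r : ℚ) ^ (n - 1) * r := by
    rw [card_reflectionGroup_one, mul_assoc, pow_sub_one_mul (NeZero.ne n)]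
    push_cast
    ring
  rw [factorizationSeries_of_isLongCycle (one_dvd r) hω hπ, hone,
    expSeries_ncard_reflections_sub, hcard, mul_pow, expSeries_pow, smul_mul_assoc, mul_assoc,
    mul_pow_sub_one (NeZero.ne n), smul_smul, ← mul_inv]

end ChapuyStump

end ReflectionFactorization
end

open ReflectionFactorization in
theorem corollary3p5 (r s n : ℕ) (hr : 0 < r) (hs : 0 < s) (hsr : s ∣ r) (hn : 0 < n)
    (ω : GL (Fin n) ℂ) (hω : ω ∈ reflectionGroup r s n) (hπ : IsLongCycle (piMatrix ω)) :
    -- the formula for the factorization series of `ω`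
    (factorizationSeries r s ω =
      PowerSeries.C (1 / ((n.factorial : ℚ) * (r : ℚ) ^ (n - 1))) *
        PowerSeries.rescale (n : ℚ) (factorizationSeries r s (toGLOne (phi ω))) *
        (expSeries ((r : ℚ) * n / 2) - expSeries (-((r : ℚ) * n / 2))) ^ (n - 1)) ∧
    -- the factorization series of `φ(ω) ∈ μ_{r/s} = G(r,s,1)`
    (toGLOne (phi ω) ∈ reflectionGroup r s 1 ∧
      factorizationSeries r s (toGLOne (phi ω)) =
        PowerSeries.C (1 / ((r : ℚ) / s)) * (expSeries ((r : ℚ) / s - 1) - expSeries (-1)) +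
          PowerSeries.C (delta ω) * expSeries (-1)) ∧
    -- the Chapuy–Stump formula for `G(r,1,n)`
    (s = 1 → phi ω ≠ 1 →
      factorizationSeries r s ω =
        PowerSeries.C (1 / (Nat.card (reflectionGroup r s n) : ℚ)) *
          (expSeries (((reflections r s n).ncard : ℚ) / n) -
            expSeries (-(((reflectingHyperplanes r s n).ncard : ℚ) / n))) ^ n) := by
  have : NeZero r := ⟨hr.ne'⟩
  have : NeZero n := ⟨hn.ne'⟩
  obtain ⟨b, hb⟩ := exists_mem_quotientRoots_eq_phi hsr hω
  simp only [one_div, ← PowerSeries.smul_eq_C_mul, smul_mul_assoc]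
  refine ⟨factorizationSeries_of_isLongCycle hsr hω hπ,
    ⟨hb ▸ toGLOne_mem_reflectionGroup hsr b, factorizationSeries_toGLOne_phi hsr hω⟩, ?_⟩
  rintro rfl hφ
  exact factorizationSeries_of_phi_ne_one hω hπ hφ
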